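/- **Setting.** The base station is at the origin of the plane. $K\ge 1$ relays are evenly spaced on the circle of radius $R_1>0$. The far users form a homogeneous Poisson point process of density $\lambda_f>0$ on the ring $\{R_2\le|z|\le R_3\}$, $R_1<R_2<R_3$. The selected far user $U$ is the one nearest to the base station, and the relay nearest to $U$ transmits to it; write $\ell(U)$ for the distance of $U$ to the base station and $\ell(\mathbb R,U)$ for its distance to the selected relay. The relay has $N_R\ge1$ receive and $N_T\ge2$ transmit antennas. The channels $h_R\in\mathbb C^{N_R}$ (base station to relay), $H_{RR}\in\mathbb C^{N_R\times N_T}$ (residual self-interference) and $f\in\mathbb C^{N_T}$ (relay to $U$) are independent of each other and of the locations, with i.i.d. entries $\mathcal{CN}(0,1)$, $\mathcal{CN}(0,\sigma_{RR}^2)$ and $\mathcal{CN}(0,1)$ respectively, $\sigma_{RR}^2>0$. The relay uses $w_r=h_R/\|h_R\|$ and transmit zero forcing (TZF): $w_t$ maximizes $|f^Tw|^2$ among unit vectors $w$ with $h_R^\dagger H_{RR}w=0$. Let $\alpha\ge2$ be the path loss exponent, $\rho_s=P_S/\sigma_n^2$ and $\rho_r=P_R/\sigma_n^2$ the normalized transmit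 powers of base station and relay ($P_S,P_R,\sigma_n^2>0$), $0<a_1<a_2$, $a_1+a_2=1$ the power allocation coefficients, $\mathcal R_2>0$ the rate of the far user, $\tau_2=2^{\mathcal R_2}-1$, and assume $\tau_2<a_2/a_1$. Put $$\gamma_R=\frac{\rho_sa_2R_1^{-\alpha}|w_r^\dagger h_R|^2}{\rho_sa_1R_1^{-\alpha}|w_r^\dagger h_R|^2+\rho_r|w_r^\dagger H_{RR}w_t|^2+1},\qquad \gamma_2=\rho_r\,\ell(\mathbb R,U)^{-\alpha}|f^Tw_t|^2,$$ and let $\tilde\gamma_2$ be $\gamma_2$ with $\ell(\mathbb R,U)$ replaced by $\ell(U)$ (the approximation used when $R_2\gg R_1$). Let $P_{\rm out}$ be the conditional probability, given that there is at least one far user, of the outage event $\{\gamma_R<\tau_2\}\cup\{\gamma_R>\tau_2,\ \gamma_2<\tau_2\}$, and let $\tilde P_{\rm out}$ be the same with $\tilde\gamma_2$. **Claim.** With probabilities conditional on there being a far user, $P_{\rm out}=\Pr(\gamma_R<\tau_2)+\Pr(\gamma_R>\tau_2)\Pr(\gamma_2<\tau_2)$, and likewise for $\tilde P_{\rm out}$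 and $\tilde\gamma_2$. For $M\ge1$ let $$F_M=1-\frac{b_4}{\Gamma(N_R)}\,\Gamma\!\Big(N_R,\frac{\tau_2R_1^\alpha}{\rho_s(a_2-\tau_2a_1)}\Big)\sum_{k=0}^{N_T-2}\frac{\beta^k}{k!}\sum_{m=1}^M\sqrt{1-\phi_m^2}\;s_m^{\alpha k+1}e^{-(\beta s_m^\alpha+\pi\lambda_fs_m^2)},$$ where $\Gamma(\cdot,\cdot)$ is the upper incomplete Gamma function, $\beta=\tau_2/\rho_r$, $\phi_m=\cos\frac{(2m-1)\pi}{2M}$, $s_m=\frac{R_3-R_2}2(\phi_m+1)+R_2$, $b_4=\frac{\upsilon_f\,\pi(R_3-R_2)e^{\pi\lambda_fR_2^2}}{2M}$ and $\upsilon_f=\frac{2\pi\lambda_f}{1-e^{-\pi\lambda_f(R_3^2-R_2^2)}}$. Then $P_{\rm out}\approx F_M$ in the following sense: there are a constant $C$ depending only on $\alpha$ and $N_T$, and a constant $E$ depending on the parameters of the network but not on $M$, such that for all $M\ge1$ $$|\tilde P_{\rm out}-F_M|\le \frac{E}{M^2},\qquad |P_{\rm out}-F_M|\le C\,\frac{R_1}{R_2}+\frac{E}{M^2}.$$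 -/

import Mathlib

open MeasureTheory ProbabilityTheory
open scoped Matrix NNReal

/-! ### Probabilistic ingredients -/

/-- The circularly symmetric complex Gaussian law `CN(0, v)`: the real and imaginary parts are
independent centred real Gaussians of variance `v / 2`. -/
noncomputable def complexGaussian (v : ℝ≥0) : Measure ℂ :=
  ((gaussianReal 0 (v / 2)).prod (gaussianReal 0 (v / 2))).map (fun z : ℝ × ℝ => (⟨z.1, z.2⟩ : ℂ))

/-- The law of a vector of length `n` with i.i.d. `CN(0, v)` entries. -/
noncomputable def gaussianVectorLaw (n : ℕ) (v : ℝ≥0) : Measure (Fin n → ℂ) :=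
  Measure.pi fun _ => complexGaussian v

/-- The law of an `m × n` array with i.i.d. `CN(0, v)` entries. -/
noncomputable def gaussianMatrixLaw (m n : ℕ) (v : ℝ≥0) : Measure (Fin m → Fin n → ℂ) :=
  Measure.pi fun _ => gaussianVectorLaw n v

/-- `Φ` is a homogeneous Poisson point process of density `lam` on the bounded region `D` of the
plane: a random finite subset of `D`, whose numbers of points in measurable sets `A` are
Poisson distributed with mean `lam * area (A ∩ D)`, and are independent for disjoint sets. -/
structure IsPoissonProcessOn {Ω : Type*} [MeasurableSpace Ω] (P : Measure Ω)
    (D : Set ℂ) (lam : ℝ) (Φ : Ω → Set ℂ) : Prop where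
  subset : ∀ ω, Φ ω ⊆ D
  finite : ∀ ω, (Φ ω).Finite
  measurable_count : ∀ A : Set ℂ, MeasurableSet A → Measurable fun ω => (Φ ω ∩ A).ncard
  law_count : ∀ A : Set ℂ, MeasurableSet A →
    HasLaw (fun ω => (Φ ω ∩ A).ncard)
      (poissonMeasure (lam * (volume : Measure ℂ).real (A ∩ D)).toNNReal) P
  indep_count : ∀ (n : ℕ) (A : Fin n → Set ℂ), (∀ i, MeasurableSet (A i)) →
    Pairwise (fun i j => Disjoint (A i) (A j)) →
    iIndepFun (fun i ω => (Φ ω ∩ A i).ncard) P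

/-- The σ-algebra generated by a point process `Φ` (through its counts) and a random point `U`. -/
noncomputable abbrev locationSigma {Ω : Type*} (Φ : Ω → Set ℂ) (U : Ω → ℂ) : MeasurableSpace Ω :=
  (⨆ A : {A : Set ℂ // MeasurableSet A},
    MeasurableSpace.comap (fun ω => (Φ ω ∩ A.1).ncard) inferInstance) ⊔
  MeasurableSpace.comap U inferInstance

/-! ### System parameters -/

/-- The deterministic parameters of the network. -/
structure NomaParams where
  /-- path loss exponent -/
  α : ℝ
  /-- number of receive antennas of the relay -/
  NR : ℕ
  /-- number of transmit antennas of the relay -/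
  NT : ℕ
  /-- number of relays -/
  K : ℕ
  /-- angle of the first relay -/
  θ₀ : ℝ
  /-- distance of the relays from the base station -/
  R₁ : ℝ
  /-- inner radius of the ring of far users -/
  R₂ : ℝ
  /-- outer radius of the ring of far users -/
  R₃ : ℝ
  /-- density of the far users -/
  lamF : ℝ
  /-- transmit power of the base station -/
  PS : ℝ
  /-- transmit power of the relay -/
  PR : ℝ
  /-- noise power -/
  noise : ℝ
  /-- power allocation coefficient of the near user -/
  a₁ : ℝ
  /-- power allocation coefficient of the far user -/
  a₂ : ℝ
  /-- transmission rate of the far user -/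
  rate₂ : ℝ
  /-- variance of the entries of the residual self-interference channel -/
  varRR : ℝ≥0

namespace NomaParams

/-- Normalized transmit power of the base station. -/
noncomputable def ρs (p : NomaParams) : ℝ := p.PS / p.noise

/-- Normalized transmit power of the relay. -/
noncomputable def ρr (p : NomaParams) : ℝ := p.PR / p.noise

/-- Decoding threshold of the far user's message. -/
noncomputable def τ₂ (p : NomaParams) : ℝ := (2 : ℝ) ^ p.rate₂ - 1

/-- The standing assumptions on the parameters. -/
structure Admissible (p : NomaParams) : Prop where
  two_le_α : 2 ≤ p.α
  one_le_NR : 1 ≤ p.NR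
  two_le_NT : 2 ≤ p.NT
  one_le_K : 1 ≤ p.K
  R₁_pos : 0 < p.R₁
  R₁_lt_R₂ : p.R₁ < p.R₂
  R₂_lt_R₃ : p.R₂ < p.R₃
  lamF_pos : 0 < p.lamF
  PS_pos : 0 < p.PS
  PR_pos : 0 < p.PR
  noise_pos : 0 < p.noise
  a₁_pos : 0 < p.a₁
  a₁_lt_a₂ : p.a₁ < p.a₂
  a_sum : p.a₁ + p.a₂ = 1
  rate₂_pos : 0 < p.rate₂
  τ₂_lt : p.τ₂ < p.a₂ / p.a₁
  varRR_pos : 0 < p.varRR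

/-- The ring in which the far users live; the base station is the origin. -/
def ring (p : NomaParams) : Set ℂ := {z | p.R₂ ≤ ‖z‖ ∧ ‖z‖ ≤ p.R₃}

/-- Positions of the relays: evenly spaced on the circle of radius `R₁`. -/
noncomputable def relayPos (p : NomaParams) (k : Fin p.K) : ℂ :=
  (p.R₁ : ℂ) * Complex.exp (((p.θ₀ + 2 * Real.pi * (k : ℝ) / (p.K : ℝ) : ℝ) : ℂ) * Complex.I)

/-- Distance from a far user at `u` to its selected relay, which is the relay closest to `u`. -/
noncomputable def relayDist (p : NomaParams) (u : ℂ) : ℝ := ⨅ k : Fin p.K, dist (p.relayPos k) u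

end NomaParams

/-! ### Beamforming and signal-to-noise ratios -/

/-- Euclidean norm of a complex vector. -/
noncomputable def vecNorm {n : ℕ} (v : Fin n → ℂ) : ℝ := ‖WithLp.toLp 2 v‖

/-- Maximal ratio combining vector `h / ‖h‖`. -/
noncomputable def mrc {n : ℕ} (h : Fin n → ℂ) : Fin n → ℂ := fun i => h i / (vecNorm h : ℂ)

/-- `w` is a transmit zero-forcing beamformer: it maximizes `|fᵀ w|²` among the unit vectors with
`h† H w = 0`. -/
def IsTZF {m n : ℕ} (h : Fin m → ℂ) (H : Fin m → Fin n → ℂ) (f w : Fin n → ℂ) : Prop :=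
  vecNorm w = 1 ∧ star h ⬝ᵥ (Matrix.of H *ᵥ w) = 0 ∧
  ∀ v : Fin n → ℂ, vecNorm v = 1 → star h ⬝ᵥ (Matrix.of H *ᵥ v) = 0 →
    ‖f ⬝ᵥ v‖ ^ 2 ≤ ‖f ⬝ᵥ w‖ ^ 2

/-- SINR at the relay, for the far user's symbol, with receive vector `wr` and transmit
vector `wt`. -/
noncomputable def relaySINR (p : NomaParams) (h : Fin p.NR → ℂ) (H : Fin p.NR → Fin p.NT → ℂ)
    (wr : Fin p.NR → ℂ) (wt : Fin p.NT → ℂ) : ℝ :=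
  p.ρs * p.a₂ * p.R₁ ^ (-p.α) * ‖star wr ⬝ᵥ h‖ ^ 2 /
    (p.ρs * p.a₁ * p.R₁ ^ (-p.α) * ‖star wr ⬝ᵥ h‖ ^ 2 +
      p.ρr * ‖star wr ⬝ᵥ (Matrix.of H *ᵥ wt)‖ ^ 2 + 1)

/-- SNR at a far user at distance `d` from the transmitting relay. -/
noncomputable def farSNR (p : NomaParams) (d : ℝ) (f wt : Fin p.NT → ℂ) : ℝ :=
  p.ρr * d ^ (-p.α) * ‖f ⬝ᵥ wt‖ ^ 2

/-! ### The random model -/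

/-- Full-duplex relay network under NNNF selection with the TZF scheme: `h` is the channel from the
base station to the relay, `H` the residual self-interference channel, `f` the channel from the
relay to the selected far user, `Φ` the set of far users, `U` the far user nearest to the base
station (whenever there is one) and `w` the transmit beamformer. -/
structure IsNNNFModel {Ω : Type*} [MeasurableSpace Ω] (P : Measure Ω) (p : NomaParams)
    (h : Ω → Fin p.NR → ℂ) (H : Ω → Fin p.NR → Fin p.NT → ℂ) (f : Ω → Fin p.NT → ℂ)
    (Φ : Ω → Set ℂ) (U : Ω → ℂ) (w : Ω → Fin p.NT → ℂ) : Prop where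
  measurable_h : Measurable h
  measurable_H : Measurable H
  measurable_f : Measurable f
  measurable_U : Measurable U
  /-- the three channels are independent with i.i.d. Gaussian entries -/
  law_channels : HasLaw (fun ω => (h ω, H ω, f ω))
    ((gaussianVectorLaw p.NR 1).prod
      ((gaussianMatrixLaw p.NR p.NT p.varRR).prod (gaussianVectorLaw p.NT 1))) P
  poisson : IsPoissonProcessOn P p.ring p.lamF Φ
  nearest_mem : ∀ ω, (Φ ω).Nonempty → U ω ∈ Φ ω
  nearest_le : ∀ ω, ∀ x ∈ Φ ω, ‖U ω‖ ≤ ‖x‖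
  /-- the channels are independent of the locations -/
  indep : Indep (MeasurableSpace.comap (fun ω => (h ω, H ω, f ω)) inferInstance)
    (locationSigma Φ U) P
  tzf : ∀ᵐ ω ∂P, IsTZF (h ω) (H ω) (f ω) (w ω)

/-! ### Outage probability -/

/-- Probability of the outage event at the far user: either the relay cannot decode, or it can
and the far user cannot. -/
noncomputable def outageProb {Ω : Type*} [MeasurableSpace Ω] (Q : Measure Ω)
    (γR γ₂ : Ω → ℝ) (τ : ℝ) : ℝ :=
  Q.real {ω | γR ω < τ ∨ (τ < γR ω ∧ γ₂ ω < τ)}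

/-- The same with the two hops separated:
`ℙ(γR < τ) + ℙ(γR > τ) ℙ(γ₂ < τ)`. -/
noncomputable def outageProbSplit {Ω : Type*} [MeasurableSpace Ω] (Q : Measure Ω)
    (γR γ₂ : Ω → ℝ) (τ : ℝ) : ℝ :=
  Q.real {ω | γR ω < τ} + Q.real {ω | τ < γR ω} * Q.real {ω | γ₂ ω < τ}

/-- Outage probability of the selected far user given that there is at least one far user, where
`d` is the distance that enters its path loss. -/
noncomputable def nnnfOutage {Ω : Type*} [MeasurableSpace Ω] (P : Measure Ω) (p : NomaParams)
    (h : Ω → Fin p.NR → ℂ) (H : Ω → Fin p.NR → Fin p.NT → ℂ) (f : Ω → Fin p.NT → ℂ)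
    (Φ : Ω → Set ℂ) (w : Ω → Fin p.NT → ℂ) (d : Ω → ℝ) : ℝ :=
  outageProb (ProbabilityTheory.cond P {ω | (Φ ω).Nonempty})
    (fun ω => relaySINR p (h ω) (H ω) (mrc (h ω)) (w ω))
    (fun ω => farSNR p (d ω) (f ω) (w ω)) p.τ₂

/-- The same with the two hops separated. -/
noncomputable def nnnfOutageSplit {Ω : Type*} [MeasurableSpace Ω] (P : Measure Ω) (p : NomaParams)
    (h : Ω → Fin p.NR → ℂ) (H : Ω → Fin p.NR → Fin p.NT → ℂ) (f : Ω → Fin p.NT → ℂ)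
    (Φ : Ω → Set ℂ) (w : Ω → Fin p.NT → ℂ) (d : Ω → ℝ) : ℝ :=
  outageProbSplit (ProbabilityTheory.cond P {ω | (Φ ω).Nonempty})
    (fun ω => relaySINR p (h ω) (H ω) (mrc (h ω)) (w ω))
    (fun ω => farSNR p (d ω) (f ω) (w ω)) p.τ₂

/-! ### The closed-form expression -/

/-- Upper incomplete Gamma function. -/
noncomputable def upperGamma (a x : ℝ) : ℝ :=
  ∫ t in Set.Ioi x, Real.exp (-t) * t ^ (a - 1)

namespace NomaParams

/-- Decoding threshold relative to the normalized relay power. -/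
noncomputable def β (p : NomaParams) : ℝ := p.τ₂ / p.ρr

/-- Normalizing constant of the density of the nearest far user's distance. -/
noncomputable def υf (p : NomaParams) : ℝ :=
  2 * Real.pi * p.lamF / (1 - Real.exp (-(Real.pi * p.lamF * (p.R₃ ^ 2 - p.R₂ ^ 2))))

/-- Prefactor of the closed-form expression. -/
noncomputable def b₄ (p : NomaParams) (M : ℕ) : ℝ :=
  p.υf * Real.pi * (p.R₃ - p.R₂) * Real.exp (Real.pi * p.lamF * p.R₂ ^ 2) / (2 * M)

/-- The Chebyshev nodes `cos ((2m - 1) π / (2M))`. -/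
noncomputable def φ (M m : ℕ) : ℝ := Real.cos ((2 * (m : ℝ) - 1) / (2 * (M : ℝ)) * Real.pi)

/-- The nodes moved from `[-1, 1]` to `[R₂, R₃]`. -/
noncomputable def s (p : NomaParams) (M m : ℕ) : ℝ :=
  (p.R₃ - p.R₂) / 2 * (φ M m + 1) + p.R₂

/-- The `M`-node closed-form expression of the outage probability. -/
noncomputable def outageFormula (p : NomaParams) (M : ℕ) : ℝ :=
  1 - p.b₄ M / Real.Gamma p.NR *
      upperGamma p.NR (p.τ₂ * p.R₁ ^ p.α / (p.ρs * (p.a₂ - p.τ₂ * p.a₁))) *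
    ∑ k ∈ Finset.range (p.NT - 1), p.β ^ k / (k.factorial : ℝ) *
      ∑ m ∈ Finset.Icc 1 M, √(1 - φ M m ^ 2) * p.s M m ^ (p.α * k + 1) *
        Real.exp (-(p.β * p.s M m ^ p.α + Real.pi * p.lamF * p.s M m ^ 2))

end NomaParams

/-! Zero forcing removes the self-interference, so the SINR at the relay is an increasing function
of `‖h‖²`, and the relay decodes exactly when `‖h‖²` exceeds a threshold `x₀`, which is positive
because `τ₂ < a₂ / a₁`. With `c = h† H`, the beamformer maximizes `|fᵀ w|²` over the unit vectors
with `c ⬝ w = 0`; by Cauchy–Schwarz the maximum is the squared norm of the component of `f`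
orthogonal to `c` (`IsTZF.norm_sq_eq`).

The law of `f` is unitarily invariant, so for every fixed `c ≠ 0` this gain follows the Gamma law of
shape `N_T - 1`. As that law does not depend on `c`, the gain is independent of `‖h‖²`, whose law is
Gamma of shape `N_R` (`measurePreserving_channelGains`). Both are independent of the location of the
user, also after conditioning on the presence of a user. Hence the two hops separate, and the outage
probability for a path-loss distance `d` is `1 - Q_{N_R}(x₀) 𝔼[Q_{N_T-1}(β d^α)]` with `Q_n(x) =
e^{-x} ∑_{k<n} x^k / k!` (`IsNNNFModel.nnnfOutage_eq`).

For `d = ‖U‖`, void probabilities of the Poisson process give the density of `‖U‖`, and the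
expectation becomes an integral over `[R₂, R₃]`. Writing `r` as an affine function of `cos t` turns
it into the integral of a smooth function over `[0, π]`. The closed form is the composite midpoint
rule in `t`, with error `O(M⁻²)`.

For the true distance, `|d - ‖U‖| ≤ R₁` by the triangle inequality. Since `x |Q_n'(x)| ≤ n`, the map
`Q_n(β d^α)` is Lipschitz in `log d` with constant `α n`, uniformly in `β`; this is why `C` depends
only on `α` and `N_T`. -/

/-! ### Complex Gaussian vectors and their unitary invariance -/

instance isProbabilityMeasure_complexGaussian (v : ℝ≥0) :
    IsProbabilityMeasure (complexGaussian v) :=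
  Measure.isProbabilityMeasure_map
    (Complex.measurableEquivRealProd.symm.measurable.aemeasurable)

instance isProbabilityMeasure_gaussianVectorLaw (n : ℕ) (v : ℝ≥0) :
    IsProbabilityMeasure (gaussianVectorLaw n v) := by
  unfold gaussianVectorLaw; infer_instance

instance isProbabilityMeasure_gaussianMatrixLaw (m n : ℕ) (v : ℝ≥0) :
    IsProbabilityMeasure (gaussianMatrixLaw m n v) := by
  unfold gaussianMatrixLaw; infer_instance

instance sFinite_gaussianVectorLaw (n : ℕ) (v : ℝ≥0) : SFinite (gaussianVectorLaw n v) :=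
  inferInstance

instance sFinite_gaussianMatrixLaw (m n : ℕ) (v : ℝ≥0) : SFinite (gaussianMatrixLaw m n v) :=
  inferInstance

theorem integral_complexGaussian (v : ℝ≥0) (g : ℂ → ℂ) (hg : Continuous g) :
    ∫ z, g z ∂complexGaussian v =
      ∫ z : ℝ × ℝ, g ⟨z.1, z.2⟩ ∂((gaussianReal 0 (v / 2)).prod (gaussianReal 0 (v / 2))) :=
  integral_map (Complex.measurableEquivRealProd.symm.measurable.aemeasurable)
    hg.aestronglyMeasurable

theorem charFun_complexGaussian (v : ℝ≥0) (t : ℂ) :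
    charFun (complexGaussian v) t = Complex.exp (-(v * ‖t‖ ^ 2 / 4 : ℝ)) := by
  rw [charFun_apply, integral_complexGaussian _ _ (by fun_prop)]
  have h : ∀ z : ℝ × ℝ, Complex.exp (inner ℝ (⟨z.1, z.2⟩ : ℂ) t * Complex.I) =
      Complex.exp (t.re * z.1 * Complex.I) * Complex.exp (t.im * z.2 * Complex.I) := by
    intro z
    rw [← Complex.exp_add, Complex.inner]
    congr 1
    simp
    ring
  simp_rw [h]
  rw [integral_prod_mul (fun x : ℝ => Complex.exp (t.re * x * Complex.I))
    (fun x : ℝ => Complex.exp (t.im * x * Complex.I)), ← charFun_apply_real,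
    ← charFun_apply_real, charFun_gaussianReal, charFun_gaussianReal, ← Complex.exp_add]
  congr 1
  rw [Complex.sq_norm, Complex.normSq_apply]
  push_cast
  ring

/-- The product over the coordinates depends on `t` only through its norm, which is the source of
unitary invariance. -/
theorem charFun_gaussianVectorLaw (n : ℕ) (v : ℝ≥0) (t : EuclideanSpace ℂ (Fin n)) :
    charFun ((gaussianVectorLaw n v).map (WithLp.toLp 2)) t =
      Complex.exp (-(v * ‖t‖ ^ 2 / 4 : ℝ)) := by
  rw [gaussianVectorLaw, charFun_pi]
  simp_rw [charFun_complexGaussian, ← Complex.exp_sum]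
  congr 1
  rw [EuclideanSpace.norm_sq_eq]
  push_cast
  rw [Finset.mul_sum, Finset.sum_div, Finset.sum_neg_distrib]

/-- The law of a complex Gaussian vector is invariant under unitary maps. -/
theorem gaussianVectorLaw_map_unitary {n : ℕ} (v : ℝ≥0)
    (L : EuclideanSpace ℂ (Fin n) ≃ₗᵢ[ℂ] EuclideanSpace ℂ (Fin n)) :
    ((gaussianVectorLaw n v).map (WithLp.toLp 2)).map L =
      (gaussianVectorLaw n v).map (WithLp.toLp 2) := by
  have hm : Measurable (WithLp.toLp 2 : (Fin n → ℂ) → EuclideanSpace ℂ (Fin n)) := by fun_prop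
  have : IsProbabilityMeasure ((gaussianVectorLaw n v).map
      (WithLp.toLp 2 : (Fin n → ℂ) → EuclideanSpace ℂ (Fin n))) :=
    Measure.isProbabilityMeasure_map hm.aemeasurable
  have hL : Measurable L := L.continuous.measurable
  have : IsProbabilityMeasure (((gaussianVectorLaw n v).map
      (WithLp.toLp 2 : (Fin n → ℂ) → EuclideanSpace ℂ (Fin n))).map L) :=
    Measure.isProbabilityMeasure_map hL.aemeasurable
  apply Measure.ext_of_charFun
  ext t
  have key : charFun (((gaussianVectorLaw n v).map
      (WithLp.toLp 2 : (Fin n → ℂ) → EuclideanSpace ℂ (Fin n))).map L) t =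
      charFun ((gaussianVectorLaw n v).map (WithLp.toLp 2)) (L.symm t) := by
    rw [charFun_apply, charFun_apply, integral_map hL.aemeasurable (by fun_prop)]
    congr 1
    ext x
    congr 3
    -- The characteristic function uses the real inner product, which `L` preserves because it
    -- preserves the complex one.
    have h1 : ∀ a b : EuclideanSpace ℂ (Fin n), inner ℝ a b = (inner ℂ a b).re := by
      intro a b
      simp [PiLp.inner_apply, Complex.inner, mul_comm]
    rw [h1, h1, ← L.inner_map_map x (L.symm t), L.apply_symm_apply]
  rw [key, charFun_gaussianVectorLaw, charFun_gaussianVectorLaw, L.symm.norm_map]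

/-! ### Gamma law of the squared norm, by characteristic functions -/

theorem integrableOn_pow_mul_cexp_neg_mul (n : ℕ) {b : ℂ} (hb : 0 < b.re) :
    IntegrableOn (fun x : ℝ => (x : ℂ) ^ n * Complex.exp (-b * x)) (Set.Ioi 0) := by
  have h := integrableOn_rpow_mul_exp_neg_mul_rpow (s := n) (p := 1) (b := b.re)
    (by have : (0 : ℝ) ≤ n := n.cast_nonneg
        linarith) one_pos hb
  refine Integrable.mono' h (by fun_prop) ?_
  filter_upwards [ae_restrict_mem measurableSet_Ioi] with x hx
  simp [Complex.norm_exp, abs_of_pos (Set.mem_Ioi.1 hx)]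

theorem integral_pow_mul_cexp_neg_mul (n : ℕ) {b : ℂ} (hb : 0 < b.re) :
    ∫ x in Set.Ioi (0 : ℝ), (x : ℂ) ^ n * Complex.exp (-b * x) = n.factorial / b ^ (n + 1) := by
  have hb0 : b ≠ 0 := fun h => by simp [h] at hb
  have lim : ∀ n : ℕ, Filter.Tendsto (fun x : ℝ => (x : ℂ) ^ n * Complex.exp (-b * x))
      Filter.atTop (nhds 0) := by
    intro n
    rw [tendsto_zero_iff_norm_tendsto_zero]
    have h := tendsto_rpow_mul_exp_neg_mul_atTop_nhds_zero n b.re hb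
    refine h.congr' ?_
    filter_upwards [Filter.eventually_gt_atTop 0] with x hx
    simp [Complex.norm_exp, abs_of_pos hx]
  have hd0 : ∀ x : ℝ, HasDerivAt (fun x : ℝ => Complex.exp (-b * x))
      (Complex.exp (-b * x) * (-b)) x := by
    intro x
    have := ((Complex.ofRealCLM.hasDerivAt (x := x)).const_mul (-b)).cexp
    simpa using this
  have hdp : ∀ (n : ℕ) (x : ℝ), HasDerivAt (fun x : ℝ => (x : ℂ) ^ n)
      (n * (x : ℂ) ^ (n - 1)) x := by
    intro n x
    convert! (Complex.ofRealCLM.hasDerivAt (x := x)).pow n using 1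
    simp
  induction n with
  | zero =>
    have h := integral_Ioi_of_hasDerivAt_of_tendsto (a := 0)
      (f := fun x : ℝ => Complex.exp (-b * x)) (by fun_prop) (fun x _ => hd0 x)
      (by
        have h0 := integrableOn_pow_mul_cexp_neg_mul 0 hb
        simp only [pow_zero, one_mul] at h0
        exact Integrable.mul_const h0 (-b))
      (by simpa using lim 0)
    rw [integral_mul_const] at h
    simp only [pow_zero, one_mul, zero_add, pow_one, Nat.factorial_zero, Nat.cast_one]
    simp only [Complex.ofReal_zero, mul_zero, Complex.exp_zero, zero_sub] at h
    rw [eq_div_iff hb0]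
    linear_combination -h
  | succ n ih =>
    -- Integration by parts: this derivative has integral zero over the half-line, which relates the
    -- exponents `n + 1` and `n`.
    have e : ∀ x : ℝ, HasDerivAt (fun x : ℝ => (x : ℂ) ^ (n + 1) * Complex.exp (-b * x))
      ((n + 1 : ℂ) * ((x : ℂ) ^ n * Complex.exp (-b * x)) -
        b * ((x : ℂ) ^ (n + 1) * Complex.exp (-b * x))) x := by
      intro x
      convert! (hdp (n + 1) x).mul (hd0 x) using 1
      push_cast
      simp
      ring
    have i1 := (integrableOn_pow_mul_cexp_neg_mul n hb).const_mul ((n : ℂ) + 1)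
    have i2 := (integrableOn_pow_mul_cexp_neg_mul (n + 1) hb).const_mul b
    have h := integral_Ioi_of_hasDerivAt_of_tendsto (a := 0)
      (f := fun x : ℝ => (x : ℂ) ^ (n + 1) * Complex.exp (-b * x)) (by fun_prop) (fun x _ => e x)
      (i1.sub i2) (lim (n + 1))
    rw [integral_sub i1 i2, integral_const_mul, integral_const_mul, ih] at h
    rw [Nat.factorial_succ, pow_succ b (n + 1)]
    push_cast
    simp only [Complex.ofReal_zero] at h
    field_simp at h ⊢
    simp at h
    linear_combination -h

theorem charFun_gammaMeasure_nat {n : ℕ} (hn : 1 ≤ n) (t : ℝ) :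
    charFun (gammaMeasure n 1) t = (1 / (1 - t * Complex.I)) ^ n := by
  obtain ⟨k, rfl⟩ := Nat.exists_eq_add_of_le' hn
  have hre : 0 < (1 - t * Complex.I).re := by simp
  rw [charFun_apply_real, gammaMeasure, integral_withDensity_eq_integral_toReal_smul
    (by unfold gammaPDF; exact (measurable_gammaPDFReal _ _).ennreal_ofReal)
    (by simp [gammaPDF])]
  have h : ∀ x : ℝ, (gammaPDF ((k + 1 : ℕ) : ℝ) 1 x).toReal • Complex.exp (t * x * Complex.I) =
      Set.indicator (Set.Ici 0) (fun x : ℝ => (1 / (k.factorial : ℂ)) *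
        ((x : ℂ) ^ k * Complex.exp (-(1 - t * Complex.I) * x))) x := by
    intro x
    by_cases hx : 0 ≤ x
    · rw [Set.indicator_of_mem (Set.mem_Ici.2 hx), gammaPDF,
        ENNReal.toReal_ofReal (gammaPDFReal_nonneg (by positivity) one_pos _)]
      have e : Complex.exp (-(1 - t * Complex.I) * x) =
          Complex.exp (-x) * Complex.exp (t * x * Complex.I) := by
        rw [← Complex.exp_add]; ring_nf
      rw [e, gammaPDFReal, if_pos hx]
      push_cast
      rw [Real.Gamma_nat_eq_factorial, Complex.real_smul]
      simp
      ring
    · rw [Set.indicator_of_notMem (by simpa using hx), gammaPDF, gammaPDFReal, if_neg hx]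
      simp
  simp_rw [h]
  rw [integral_indicator measurableSet_Ici, integral_Ici_eq_integral_Ioi, integral_const_mul,
    integral_pow_mul_cexp_neg_mul k hre]
  have : (k.factorial : ℂ) ≠ 0 := by exact_mod_cast k.factorial_ne_zero
  rw [one_div_pow]
  field_simp

/-- The integral itself is a complex square root. Only its square is needed, because `|z|²` is the
sum of two independent squares, and squaring disposes of the branch. -/
theorem sq_integral_gaussianReal_half_cexp_sq (t : ℝ) :
    (∫ x, Complex.exp (t * (x : ℂ) ^ 2 * Complex.I) ∂gaussianReal 0 (1 / 2)) ^ 2 =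
      1 / (1 - t * Complex.I) := by
  have hre : 0 < (1 - t * Complex.I).re := by simp
  rw [integral_gaussianReal_eq_integral_smul (by norm_num)]
  have h : ∀ x : ℝ, gaussianPDFReal 0 (1 / 2) x • Complex.exp (t * (x : ℂ) ^ 2 * Complex.I) =
      (((√Real.pi)⁻¹ : ℝ) : ℂ) * Complex.exp (-(1 - t * Complex.I) * (x : ℂ) ^ 2) := by
    intro x
    rw [gaussianPDFReal, Complex.real_smul]
    have e : Complex.exp (-(1 - t * Complex.I) * (x : ℂ) ^ 2) =
        Complex.exp (-x ^ 2) * Complex.exp (t * (x : ℂ) ^ 2 * Complex.I) := by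
      rw [← Complex.exp_add]; ring_nf
    rw [e]
    push_cast
    have e1 : 2 * Real.pi * (1 / 2) = Real.pi := by ring
    have e2 : -((x : ℂ) - 0) ^ 2 / (2 * (1 / 2)) = -x ^ 2 := by ring
    rw [e1, e2]
    ring
  simp_rw [h]
  rw [integral_const_mul, integral_gaussian_complex hre, mul_pow, one_div (2 : ℂ),
    ← Complex.ofReal_pow, inv_pow, Real.sq_sqrt Real.pi_pos.le]
  have hc : ∀ z : ℂ, (z ^ (2⁻¹ : ℂ)) ^ 2 = z := fun z => by
    simp
  rw [hc]
  have : (Real.pi : ℂ) ≠ 0 := by exact_mod_cast Real.pi_ne_zero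
  push_cast
  field_simp

theorem integral_complexGaussian_one_cexp_normSq (t : ℝ) :
    ∫ z, Complex.exp (t * (‖z‖ ^ 2 : ℝ) * Complex.I) ∂complexGaussian 1 =
      1 / (1 - t * Complex.I) := by
  rw [integral_complexGaussian _ _ (by fun_prop), ← sq_integral_gaussianReal_half_cexp_sq, sq,
    ← integral_prod_mul (fun x : ℝ => Complex.exp (t * (x : ℂ) ^ 2 * Complex.I))
      (fun x : ℝ => Complex.exp (t * (x : ℂ) ^ 2 * Complex.I))]
  refine integral_congr_ae (Filter.Eventually.of_forall fun z => ?_)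
  simp only [← Complex.exp_add, Complex.sq_norm, Complex.normSq_apply]
  congr 1
  push_cast
  ring

/-- The squared norm of a standard complex Gaussian vector follows a Gamma law. -/
theorem gaussianVectorLaw_map_normSq {n : ℕ} (hn : 1 ≤ n) :
    (gaussianVectorLaw n 1).map (fun z => ∑ i, ‖z i‖ ^ 2) = gammaMeasure n 1 := by
  have hm : Measurable (fun z : Fin n → ℂ => ∑ i, ‖z i‖ ^ 2) := by fun_prop
  have : IsProbabilityMeasure ((gaussianVectorLaw n 1).map (fun z => ∑ i, ‖z i‖ ^ 2)) :=
    Measure.isProbabilityMeasure_map hm.aemeasurable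
  have : IsProbabilityMeasure (gammaMeasure n 1) :=
    isProbabilityMeasure_gammaMeasure (by exact_mod_cast hn) one_pos
  apply Measure.ext_of_charFun
  ext t
  rw [charFun_gammaMeasure_nat hn, charFun_apply_real,
    integral_map hm.aemeasurable (by fun_prop)]
  have h : ∀ z : Fin n → ℂ, Complex.exp (t * ((∑ i, ‖z i‖ ^ 2 : ℝ) : ℂ) * Complex.I) =
      ∏ i, Complex.exp (t * (‖z i‖ ^ 2 : ℝ) * Complex.I) := by
    intro z
    rw [← Complex.exp_sum, Complex.ofReal_sum, Finset.mul_sum, Finset.sum_mul]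
  simp_rw [h]
  rw [gaussianVectorLaw, integral_fintype_prod_eq_prod
    (f := fun (_ : Fin n) (z : ℂ) => Complex.exp (t * (‖z‖ ^ 2 : ℝ) * Complex.I))]
  simp only [integral_complexGaussian_one_cexp_normSq, Finset.prod_const, Finset.card_univ,
    Fintype.card_fin]

/-! ### Projection of a Gaussian vector onto a hyperplane -/

/-- The squared norm of the component of `f` orthogonal to `c`. -/
noncomputable def orthNormSq {n : ℕ} (c f : Fin n → ℂ) : ℝ :=
  (∑ i, ‖f i‖ ^ 2) - ‖star c ⬝ᵥ f‖ ^ 2 / ∑ i, ‖c i‖ ^ 2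

theorem Measurable.orthNormSq {X : Type*} [MeasurableSpace X] {n : ℕ} {c f : X → Fin n → ℂ}
    (hc : Measurable c) (hf : Measurable f) : Measurable (fun x => orthNormSq (c x) (f x)) := by
  unfold _root_.orthNormSq dotProduct
  simp only [Pi.star_apply]
  fun_prop

theorem sum_norm_sq_pos {n : ℕ} {c : Fin n → ℂ} (hc : c ≠ 0) : 0 < ∑ i, ‖c i‖ ^ 2 := by
  obtain ⟨i, hi⟩ := Function.ne_iff.1 hc
  exact Finset.sum_pos' (fun _ _ => by positivity)
    ⟨i, Finset.mem_univ _, by have : 0 < ‖c i‖ := norm_pos_iff.2 hi; positivity⟩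

/-- The law of the squared norm of the orthogonal projection of a standard complex Gaussian
vector onto a hyperplane. -/
theorem gaussianVectorLaw_map_orthNormSq {n : ℕ} (hn : 1 ≤ n) {c : Fin (n + 1) → ℂ} (hc : c ≠ 0) :
    (gaussianVectorLaw (n + 1) 1).map (orthNormSq c) = gammaMeasure n 1 := by
  have hS := sum_norm_sq_pos hc
  set u : EuclideanSpace ℂ (Fin (n + 1)) := WithLp.toLp 2 c with hu
  have hun : ‖u‖ ^ 2 = ∑ i, ‖c i‖ ^ 2 := by rw [EuclideanSpace.norm_sq_eq]
  have hu0 : u ≠ 0 := by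
    intro h
    rw [h] at hun
    simp only [norm_zero] at hun
    rw [← hun] at hS
    norm_num at hS
  set g : EuclideanSpace ℂ (Fin (n + 1)) := ((‖u‖ : ℂ)⁻¹) • u with hg
  have hgn : ‖g‖ = 1 := by
    rw [hg, norm_smul, norm_inv, Complex.norm_real, norm_norm]
    exact inv_mul_cancel₀ (norm_ne_zero_iff.2 hu0)
  have hort : Orthonormal ℂ (({0} : Set (Fin (n + 1))).domRestrict fun _ => g) := by
    rw [orthonormal_iff_ite]
    rintro ⟨i, hi⟩ ⟨j, hj⟩
    have hij : i = j := by simp_all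
    simp [Set.domRestrict, hij, hgn, inner_self_eq_norm_sq_to_K]
  -- In an orthonormal basis whose vector of index 0 is `c / ‖c‖`, projecting away `c` deletes
  -- coordinate 0. By unitary invariance the other `n` coordinates are again i.i.d. standard.
  obtain ⟨b, hb⟩ := hort.exists_orthonormalBasis_extension_of_card_eq (by simp)
  have hb0 : b 0 = g := hb 0 (by simp)
  have hX : ∀ f : Fin (n + 1) → ℂ,
      orthNormSq c f = ∑ i : Fin n, ‖b.repr (WithLp.toLp 2 f) i.succ‖ ^ 2 := by
    intro f
    have h1 : ∑ i, ‖f i‖ ^ 2 = ∑ i, ‖b.repr (WithLp.toLp 2 f) i‖ ^ 2 := by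
      rw [← EuclideanSpace.norm_sq_eq (b.repr (WithLp.toLp 2 f)), b.repr.norm_map,
        EuclideanSpace.norm_sq_eq]
    have h2 : ‖star c ⬝ᵥ f‖ ^ 2 / ∑ i, ‖c i‖ ^ 2 = ‖b.repr (WithLp.toLp 2 f) 0‖ ^ 2 := by
      rw [b.repr_apply_apply, hb0, hg, inner_smul_left, norm_mul, mul_pow, ← hun, hu,
        EuclideanSpace.inner_toLp_toLp, dotProduct_comm f]
      simp
      ring
    rw [orthNormSq, h1, h2, Fin.sum_univ_succ]
    ring
  have hT : MeasurePreserving (fun z : Fin (n + 1) → ℂ => fun i : Fin n => z i.succ)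
      (gaussianVectorLaw (n + 1) 1) (gaussianVectorLaw n 1) := by
    have h := measurePreserving_piFinSuccAbove (fun _ : Fin (n + 1) => complexGaussian 1) 0
    exact (measurePreserving_snd (μ := complexGaussian 1) (ν := gaussianVectorLaw n 1)).comp h
  have hL : Measurable b.repr := b.repr.continuous.measurable
  have e : orthNormSq c = (fun z : Fin n → ℂ => ∑ i, ‖z i‖ ^ 2) ∘
      (fun z : Fin (n + 1) → ℂ => fun i : Fin n => z i.succ) ∘
      (WithLp.ofLp : EuclideanSpace ℂ (Fin (n + 1)) → _) ∘ b.repr ∘ WithLp.toLp 2 := by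
    funext f
    simp [hX f]
  have m1 : Measurable (fun z : Fin n → ℂ => ∑ i, ‖z i‖ ^ 2) := by fun_prop
  have m2 : Measurable (WithLp.ofLp : EuclideanSpace ℂ (Fin (n + 1)) → _) := by fun_prop
  have m3 : Measurable (WithLp.toLp 2 : _ → EuclideanSpace ℂ (Fin (n + 1))) := by fun_prop
  rw [e, ← Measure.map_map m1 (hT.measurable.comp (m2.comp (hL.comp m3))),
    ← Measure.map_map hT.measurable (m2.comp (hL.comp m3)),
    ← Measure.map_map m2 (hL.comp m3), ← Measure.map_map hL m3, gaussianVectorLaw_map_unitary,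
    Measure.map_map m2 m3]
  have : (WithLp.ofLp : EuclideanSpace ℂ (Fin (n + 1)) → _) ∘ WithLp.toLp 2 = id := rfl
  rw [this, Measure.map_id, hT.map_eq, gaussianVectorLaw_map_normSq hn]

/-! ### Almost sure nonvanishing of the zero-forcing constraint -/

theorem complexGaussian_singleton {v : ℝ≥0} (hv : 0 < v) (z : ℂ) : complexGaussian v {z} = 0 := by
  have : NullSingletonClass (gaussianReal 0 (v / 2)) :=
    nullSingletonClass_gaussianReal (by positivity)
  have hm : Measurable (fun z : ℝ × ℝ => (⟨z.1, z.2⟩ : ℂ)) :=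
    Complex.measurableEquivRealProd.symm.measurable
  have h : (fun z : ℝ × ℝ => (⟨z.1, z.2⟩ : ℂ)) ⁻¹' {z} = {(z.re, z.im)} := by
    ext w
    simp [Complex.ext_iff, Prod.ext_iff]
  rw [complexGaussian, Measure.map_apply hm (measurableSet_singleton z), h, measure_singleton]

theorem ae_gaussianVectorLaw_ne_zero {n : ℕ} (hn : 1 ≤ n) {v : ℝ≥0} (hv : 0 < v) :
    ∀ᵐ z ∂gaussianVectorLaw n v, z ≠ 0 := by
  have h := (measurePreserving_eval (fun _ : Fin n => complexGaussian v) ⟨0, hn⟩)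
  have h2 : ∀ᵐ z ∂complexGaussian v, z ≠ 0 := by
    rw [ae_iff]; simpa using complexGaussian_singleton hv 0
  filter_upwards [h.quasiMeasurePreserving.ae h2] with z hz h0
  exact hz (by simp [h0])

/-- One coordinate suffices. Choose a row `i` with `a i ≠ 0`: given the other rows, the first
coordinate of the product vanishes for a single value of the entry in row `i`, and the law of that
entry has no atoms. -/
theorem ae_gaussianMatrixLaw_vecMul_ne_zero {m n : ℕ} (hn : 1 ≤ n) {v : ℝ≥0} (hv : 0 < v)
    {a : Fin m → ℂ} (ha : a ≠ 0) :
    ∀ᵐ H ∂gaussianMatrixLaw m n v, a ᵥ* Matrix.of H ≠ 0 := by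
  obtain ⟨i, hi⟩ := Function.ne_iff.1 ha
  obtain ⟨k, rfl⟩ : ∃ k, m = k + 1 := ⟨m - 1, by have := i.pos; omega⟩
  have hp := measurePreserving_piFinSuccAbove (fun _ : Fin (k + 1) => gaussianVectorLaw n v) i
  have he := (measurePreserving_eval (fun _ : Fin n => complexGaussian v) ⟨0, hn⟩)
  have key : ∀ᵐ q ∂((gaussianVectorLaw n v).prod (Measure.pi fun _ : Fin k => gaussianVectorLaw n v)),
      a i * q.1 ⟨0, hn⟩ + ∑ j, a (i.succAbove j) * q.2 j ⟨0, hn⟩ ≠ 0 := by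
    have hs : ∀ᵐ q ∂((Measure.pi fun _ : Fin k => gaussianVectorLaw n v).prod (gaussianVectorLaw n v)),
      a i * q.2 ⟨0, hn⟩ + ∑ j, a (i.succAbove j) * q.1 j ⟨0, hn⟩ ≠ 0 := by
      refine (Measure.ae_prod_iff_ae_ae ?_).2 (Filter.Eventually.of_forall fun y => ?_)
      · exact (measurableSet_singleton (0 : ℂ)).compl.preimage (by fun_prop)
      · set s := ∑ j, a (i.succAbove j) * y j ⟨0, hn⟩
        have h2 : ∀ᵐ z ∂complexGaussian v, z ≠ -s / a i := by
          rw [ae_iff]; simpa using complexGaussian_singleton hv _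
        filter_upwards [he.quasiMeasurePreserving.ae h2] with z hz h0
        apply hz
        rw [eq_div_iff hi]
        linear_combination h0
    exact Measure.measurePreserving_swap.quasiMeasurePreserving.ae hs
  filter_upwards [hp.quasiMeasurePreserving.ae key] with H hH h0
  apply hH
  have := congrFun h0 ⟨0, hn⟩
  simp only [Matrix.vecMul, dotProduct, Pi.zero_apply, Matrix.of_apply] at this
  rw [Fin.sum_univ_succAbove _ i] at this
  exact this

/-! ### Transmit zero forcing as an orthogonal projection -/

theorem vecNorm_sq {n : ℕ} (v : Fin n → ℂ) : vecNorm v ^ 2 = ∑ i, ‖v i‖ ^ 2 := by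
  rw [vecNorm, EuclideanSpace.norm_sq_eq]

theorem vecNorm_nonneg {n : ℕ} (v : Fin n → ℂ) : 0 ≤ vecNorm v := norm_nonneg _

theorem vecNorm_pos {n : ℕ} {v : Fin n → ℂ} (hv : v ≠ 0) : 0 < vecNorm v := by
  refine (vecNorm_nonneg v).lt_of_ne' fun h => ?_
  have := sum_norm_sq_pos hv
  rw [← vecNorm_sq, h] at this
  norm_num at this

theorem star_dotProduct_self_eq {n : ℕ} (v : Fin n → ℂ) :
    star v ⬝ᵥ v = ((∑ i, ‖v i‖ ^ 2 : ℝ) : ℂ) := by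
  simp only [dotProduct, Pi.star_apply, Complex.ofReal_sum]
  refine Finset.sum_congr rfl fun i _ => ?_
  rw [Complex.star_def, ← Complex.normSq_eq_conj_mul_self, Complex.sq_norm]

theorem norm_dotProduct_sq_le {n : ℕ} (u v : Fin n → ℂ) :
    ‖u ⬝ᵥ v‖ ^ 2 ≤ (∑ i, ‖u i‖ ^ 2) * ∑ i, ‖v i‖ ^ 2 := by
  have h := norm_inner_le_norm (𝕜 := ℂ) (WithLp.toLp 2 (star u)) (WithLp.toLp 2 v)
  rw [EuclideanSpace.inner_toLp_toLp, star_star, dotProduct_comm] at h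
  have h2 := pow_le_pow_left₀ (norm_nonneg _) h 2
  rw [mul_pow, EuclideanSpace.norm_sq_eq, EuclideanSpace.norm_sq_eq] at h2
  simpa using h2

theorem sum_norm_sq_sub_proj {n : ℕ} {c : Fin n → ℂ} (hc : c ≠ 0) (f : Fin n → ℂ) :
    ∑ i, ‖(f - ((star c ⬝ᵥ f) / ((∑ i, ‖c i‖ ^ 2 : ℝ) : ℂ)) • c) i‖ ^ 2 = orthNormSq c f := by
  have hS := sum_norm_sq_pos hc
  set S := ∑ i, ‖c i‖ ^ 2 with hSdef
  have hS' : (S : ℂ) ≠ 0 := by exact_mod_cast hS.ne'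
  have h : ((∑ i, ‖(f - ((star c ⬝ᵥ f) / (S : ℂ)) • c) i‖ ^ 2 : ℝ) : ℂ) = orthNormSq c f := by
    rw [← star_dotProduct_self_eq, star_sub, star_smul, sub_dotProduct, dotProduct_sub,
      dotProduct_sub, smul_dotProduct, smul_dotProduct, dotProduct_smul, dotProduct_smul,
      star_dotProduct_self_eq, star_dotProduct_self_eq, ← hSdef, orthNormSq, ← hSdef]
    have e1 : star f ⬝ᵥ c = star (star c ⬝ᵥ f) := by
      rw [Matrix.star_dotProduct]
    have e2 : (((‖star c ⬝ᵥ f‖ ^ 2 : ℝ)) : ℂ) = star (star c ⬝ᵥ f) * (star c ⬝ᵥ f) := by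
      rw [Complex.star_def, ← Complex.normSq_eq_conj_mul_self, Complex.sq_norm]
    rw [Complex.ofReal_sub, Complex.ofReal_div, e2, e1]
    simp only [smul_eq_mul, star_div₀, Complex.star_def, Complex.conj_ofReal]
    field_simp
    ring
  exact_mod_cast h

/-- The effective channel gain under transmit zero forcing. -/
theorem IsTZF.norm_sq_eq {m n : ℕ} {h : Fin m → ℂ} {H : Fin m → Fin n → ℂ} {f w : Fin n → ℂ}
    (hw : IsTZF h H f w) (hc : star h ᵥ* Matrix.of H ≠ 0) :
    ‖f ⬝ᵥ w‖ ^ 2 = orthNormSq (star h ᵥ* Matrix.of H) f := by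
  obtain ⟨hw1, hw0, hmax⟩ := hw
  simp only [Matrix.dotProduct_mulVec] at hw0 hmax
  set c := star h ᵥ* Matrix.of H
  have hp := sum_norm_sq_sub_proj hc f
  have hS' : ((∑ i, ‖c i‖ ^ 2 : ℝ) : ℂ) ≠ 0 := by exact_mod_cast (sum_norm_sq_pos hc).ne'
  set r := (star c ⬝ᵥ f) / ((∑ i, ‖c i‖ ^ 2 : ℝ) : ℂ)
  set p := f - r • c with hpdef
  have hcp : star c ⬝ᵥ p = 0 := by
    rw [hpdef, dotProduct_sub, dotProduct_smul, star_dotProduct_self_eq, smul_eq_mul,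
      div_mul_cancel₀ _ hS', sub_self]
  have hfp : f = p + r • c := by simp [hpdef]
  -- On the feasible vectors `f` may be replaced by its projection `p`; Cauchy–Schwarz then bounds
  -- the gain from above.
  have hfv : ∀ v, c ⬝ᵥ v = 0 → f ⬝ᵥ v = p ⬝ᵥ v := by
    intro v hv
    rw [hfp, add_dotProduct, smul_dotProduct, hv, smul_zero, add_zero]
  have hw2 : ∑ i, ‖w i‖ ^ 2 = 1 := by rw [← vecNorm_sq, hw1, one_pow]
  apply le_antisymm
  · rw [hfv w hw0, ← hp]
    simpa [hw2] using norm_dotProduct_sq_le p w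
  · by_cases hp0 : p = 0
    · rw [← hp, hp0]
      simp
    · have hN := vecNorm_pos hp0
      have hN' : (vecNorm p : ℂ) ≠ 0 := by exact_mod_cast hN.ne'
      -- The equality case of Cauchy–Schwarz: the pairing is bilinear, hence the conjugate. This
      -- vector is feasible because `p` is orthogonal to `c`.
      set v : Fin n → ℂ := ((vecNorm p : ℂ)⁻¹) • star p with hv
      have hcv : c ⬝ᵥ v = 0 := by
        have : c ⬝ᵥ star p = star (star c ⬝ᵥ p) := by
          rw [Matrix.star_dotProduct, star_star, dotProduct_comm]
        rw [hv, dotProduct_smul, this, hcp]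
        simp
      have hv1 : vecNorm v = 1 := by
        have : vecNorm v ^ 2 = 1 := by
          rw [vecNorm_sq, hv]
          simp only [Pi.smul_apply, Pi.star_apply, smul_eq_mul, norm_mul, mul_pow, norm_star,
            norm_inv, Complex.norm_real, ← Finset.mul_sum]
          rw [← vecNorm_sq, Real.norm_of_nonneg hN.le]
          field_simp
        nlinarith [vecNorm_nonneg v]
      have := hmax v hv1 hcv
      refine le_trans (le_of_eq ?_) this
      rw [hfv v hcv, hv, dotProduct_smul, dotProduct_comm, star_dotProduct_self_eq, hp,
        smul_eq_mul, norm_mul, norm_inv, Complex.norm_real, Complex.norm_real,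
        Real.norm_of_nonneg hN.le, ← hp, ← vecNorm_sq, Real.norm_of_nonneg (by positivity)]
      field_simp

theorem star_mrc_dotProduct {n : ℕ} (h v : Fin n → ℂ) :
    star (mrc h) ⬝ᵥ v = (star h ⬝ᵥ v) / (vecNorm h : ℂ) := by
  simp only [mrc, dotProduct, Pi.star_apply, star_div₀, Complex.star_def, Complex.conj_ofReal,
    Finset.sum_div]
  exact Finset.sum_congr rfl fun i _ => by ring

theorem norm_star_mrc_dotProduct_self_sq {n : ℕ} (h : Fin n → ℂ) :
    ‖star (mrc h) ⬝ᵥ h‖ ^ 2 = ∑ i, ‖h i‖ ^ 2 := by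
  rw [star_mrc_dotProduct, star_dotProduct_self_eq, ← vecNorm_sq, norm_div, Complex.norm_real,
    Complex.norm_real, Real.norm_of_nonneg (sq_nonneg _), Real.norm_of_nonneg (vecNorm_nonneg h)]
  by_cases h0 : vecNorm h = 0
  · simp [h0]
  · field_simp

/-! ### Decoding thresholds for the two hops -/

namespace NomaParams

/-- The relay decodes the far user's message when the squared norm of its channel exceeds this. -/
noncomputable def relayThreshold (p : NomaParams) : ℝ :=
  p.τ₂ * p.R₁ ^ p.α / (p.ρs * (p.a₂ - p.τ₂ * p.a₁))

namespace Admissible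

variable {p : NomaParams}

theorem τ₂_pos (hp : p.Admissible) : 0 < p.τ₂ :=
  sub_pos.2 (Real.one_lt_rpow one_lt_two hp.rate₂_pos)

theorem ρs_pos (hp : p.Admissible) : 0 < p.ρs := div_pos hp.PS_pos hp.noise_pos

theorem ρr_pos (hp : p.Admissible) : 0 < p.ρr := div_pos hp.PR_pos hp.noise_pos

theorem β_pos (hp : p.Admissible) : 0 < p.β := div_pos hp.τ₂_pos hp.ρr_pos

theorem R₂_pos (hp : p.Admissible) : 0 < p.R₂ := hp.R₁_pos.trans hp.R₁_lt_R₂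

theorem gap_pos (hp : p.Admissible) : 0 < p.a₂ - p.τ₂ * p.a₁ :=
  sub_pos.2 ((lt_div_iff₀ hp.a₁_pos).1 hp.τ₂_lt)

theorem relayThreshold_pos (hp : p.Admissible) : 0 < p.relayThreshold :=
  div_pos (mul_pos hp.τ₂_pos (Real.rpow_pos_of_pos hp.R₁_pos _)) (mul_pos hp.ρs_pos hp.gap_pos)

end Admissible

end NomaParams

theorem relaySINR_mrc {p : NomaParams} {h : Fin p.NR → ℂ} {H : Fin p.NR → Fin p.NT → ℂ}
    {w : Fin p.NT → ℂ} (hw : star h ⬝ᵥ (Matrix.of H *ᵥ w) = 0) :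
    relaySINR p h H (mrc h) w =
      p.ρs * p.a₂ * p.R₁ ^ (-p.α) * (∑ i, ‖h i‖ ^ 2) /
        (p.ρs * p.a₁ * p.R₁ ^ (-p.α) * (∑ i, ‖h i‖ ^ 2) + 1) := by
  rw [relaySINR, norm_star_mrc_dotProduct_self_sq, star_mrc_dotProduct, hw]
  simp

/-- After clearing positive denominators, SINR minus `τ₂` has the sign of `s` minus the threshold,
because `a₂ - τ₂ a₁ > 0`. Both strict comparisons are recorded since the outage event leaves out
equality. -/
theorem NomaParams.Admissible.sinr_cmp {p : NomaParams} (hp : p.Admissible) {s : ℝ} (hs : 0 ≤ s) :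
    (p.ρs * p.a₂ * p.R₁ ^ (-p.α) * s / (p.ρs * p.a₁ * p.R₁ ^ (-p.α) * s + 1) < p.τ₂ ↔
      s < p.relayThreshold) ∧
    (p.τ₂ < p.ρs * p.a₂ * p.R₁ ^ (-p.α) * s / (p.ρs * p.a₁ * p.R₁ ^ (-p.α) * s + 1) ↔
      p.relayThreshold < s) := by
  have h1 := hp.ρs_pos
  have h2 := hp.a₁_pos
  have h3 : 0 < p.R₁ ^ p.α := Real.rpow_pos_of_pos hp.R₁_pos _
  have h4 := hp.gap_pos
  rw [Real.rpow_neg hp.R₁_pos.le, NomaParams.relayThreshold]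
  set A := p.R₁ ^ p.α
  have hd : 0 < p.ρs * p.a₁ * A⁻¹ * s + 1 := by positivity
  have e : (p.ρs * p.a₂ * A⁻¹ * s - p.τ₂ * (p.ρs * p.a₁ * A⁻¹ * s + 1)) * A =
      s * (p.ρs * (p.a₂ - p.τ₂ * p.a₁)) - p.τ₂ * A := by
    field_simp
    ring
  constructor
  · rw [div_lt_iff₀ hd, lt_div_iff₀ (mul_pos h1 h4), ← sub_neg, ← sub_neg (a := s * _), ← e]
    exact ⟨fun h => mul_neg_of_neg_of_pos h h3, fun h => neg_of_mul_neg_left h h3.le⟩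
  · rw [lt_div_iff₀ hd, div_lt_iff₀ (mul_pos h1 h4), ← sub_pos, ← sub_pos (b := p.τ₂ * A), ← e]
    exact ⟨fun h => mul_pos h h3, fun h => pos_of_mul_pos_left h h3.le⟩

theorem NomaParams.Admissible.farSNR_lt_iff {p : NomaParams} (hp : p.Admissible) {d : ℝ}
    (hd : 0 < d) (f w : Fin p.NT → ℂ) :
    farSNR p d f w < p.τ₂ ↔ ‖f ⬝ᵥ w‖ ^ 2 < p.β * d ^ p.α := by
  have h1 := hp.ρr_pos
  have h2 : 0 < d ^ p.α := Real.rpow_pos_of_pos hd _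
  rw [farSNR, Real.rpow_neg hd.le, NomaParams.β, ← sub_neg, ← sub_neg (a := ‖f ⬝ᵥ w‖ ^ 2)]
  have e : p.ρr * (d ^ p.α)⁻¹ * ‖f ⬝ᵥ w‖ ^ 2 - p.τ₂ =
      (‖f ⬝ᵥ w‖ ^ 2 - p.τ₂ / p.ρr * d ^ p.α) * (p.ρr / d ^ p.α) := by
    field_simp
  rw [e]
  exact ⟨fun h => neg_of_mul_neg_left h (by positivity),
    fun h => mul_neg_of_neg_of_pos h (by positivity)⟩

/-! ### Joint law of the channel gains -/

/-- The squared norms of the received channel and of the effective transmit channel. -/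
noncomputable def channelGains {m n : ℕ}
    (q : (Fin m → ℂ) × (Fin m → Fin n → ℂ) × (Fin n → ℂ)) : ℝ × ℝ :=
  (∑ i, ‖q.1 i‖ ^ 2, orthNormSq (star q.1 ᵥ* Matrix.of q.2.1) q.2.2)

theorem Measurable.star_vecMul {X : Type*} [MeasurableSpace X] {m n : ℕ} {h : X → Fin m → ℂ}
    {H : X → Fin m → Fin n → ℂ} (hh : Measurable h) (hH : Measurable H) :
    Measurable (fun x => star (h x) ᵥ* Matrix.of (H x)) := by
  refine measurable_pi_lambda _ fun j => ?_
  simp only [Matrix.vecMul, dotProduct, Pi.star_apply, Matrix.of_apply]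
  fun_prop

theorem ae_vecMul_star_ne_zero {m n : ℕ} (hm : 1 ≤ m) (hn : 1 ≤ n) {v : ℝ≥0} (hv : 0 < v) :
    ∀ᵐ q ∂((gaussianVectorLaw m 1).prod (gaussianMatrixLaw m n v)),
      star q.1 ᵥ* Matrix.of q.2 ≠ 0 := by
  refine (Measure.ae_prod_iff_ae_ae ?_).2 ?_
  · exact (measurableSet_singleton (0 : Fin n → ℂ)).compl.preimage
      (.star_vecMul measurable_fst measurable_snd)
  · filter_upwards [ae_gaussianVectorLaw_ne_zero hm one_pos] with h hh
    exact ae_gaussianMatrixLaw_vecMul_ne_zero hn hv (star_ne_zero.2 hh)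

theorem isProbabilityMeasure_gammaMeasure_nat {n : ℕ} (hn : 1 ≤ n) :
    IsProbabilityMeasure (gammaMeasure n 1) :=
  isProbabilityMeasure_gammaMeasure (by exact_mod_cast hn) one_pos

/-- The channel gains are independent and follow Gamma laws. -/
theorem measurePreserving_channelGains {m n : ℕ} (hm : 1 ≤ m) (hn : 2 ≤ n) {v : ℝ≥0}
    (hv : 0 < v) :
    MeasurePreserving (channelGains (m := m) (n := n))
      ((gaussianVectorLaw m 1).prod
        ((gaussianMatrixLaw m n v).prod (gaussianVectorLaw n 1)))
      ((gammaMeasure m 1).prod (gammaMeasure (n - 1 : ℕ) 1)) := by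
  obtain ⟨n, rfl⟩ : ∃ k, n = k + 1 := ⟨n - 1, by omega⟩
  replace hn : 1 ≤ n := by omega
  rw [Nat.add_sub_cancel]
  have := isProbabilityMeasure_gammaMeasure_nat hm
  have := isProbabilityMeasure_gammaMeasure_nat hn
  have h1 : MeasurePreserving (fun q : (Fin m → ℂ) × (Fin m → Fin (n + 1) → ℂ) => ∑ i, ‖q.1 i‖ ^ 2)
      ((gaussianVectorLaw m 1).prod (gaussianMatrixLaw m (n + 1) v)) (gammaMeasure m 1) :=
    (⟨by fun_prop, gaussianVectorLaw_map_normSq hm⟩ :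
      MeasurePreserving (fun z : Fin m → ℂ => ∑ i, ‖z i‖ ^ 2) (gaussianVectorLaw m 1)
        (gammaMeasure m 1)).comp measurePreserving_fst
  -- For almost every `(h, H)` the gain has the same law given `(h, H)`. A skew product with
  -- constant fibre law is a product, which gives independence although the gain involves `h`.
  have h2 := h1.skew_product (μc := gaussianVectorLaw (n + 1) 1) (μd := gammaMeasure n 1)
    (g := fun q f => orthNormSq (star q.1 ᵥ* Matrix.of q.2) f)
    (.orthNormSq (.star_vecMul (measurable_fst.comp measurable_fst)
      (measurable_snd.comp measurable_fst)) measurable_snd)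
    (by
      filter_upwards [ae_vecMul_star_ne_zero hm (Nat.le_add_left 1 n) hv] with q hq
      exact gaussianVectorLaw_map_orthNormSq hn hq)
  have h3 := (measurePreserving_prodAssoc (gaussianVectorLaw m 1) (gaussianMatrixLaw m (n + 1) v)
    (gaussianVectorLaw (n + 1) 1)).symm MeasurableEquiv.prodAssoc
  exact h2.comp h3

/-! ### Gamma tails of integer shape -/

/-- Tail of the Gamma law with integer shape `n` and rate one. -/
noncomputable def erlangTail (n : ℕ) (x : ℝ) : ℝ :=
  Real.exp (-x) * ∑ k ∈ Finset.range n, x ^ k / (k.factorial : ℝ)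

theorem continuous_erlangTail (n : ℕ) : Continuous (erlangTail n) := by
  unfold erlangTail; fun_prop

/-- The derivatives of the summands telescope, and only the top term survives: minus the Gamma
density of shape `n + 1`. -/
theorem hasDerivAt_erlangTail (n : ℕ) (x : ℝ) :
    HasDerivAt (erlangTail (n + 1)) (-(x ^ n * Real.exp (-x) / (n.factorial : ℝ))) x := by
  induction n with
  | zero =>
    have h := (hasDerivAt_neg x).exp
    have e : erlangTail 1 = fun x => Real.exp (-x) := by
      funext y
      simp [erlangTail]
    rw [zero_add, e]
    simpa using h
  | succ n ih =>
    have e : erlangTail (n + 1 + 1) = fun x => erlangTail (n + 1) x +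
        Real.exp (-x) * (x ^ (n + 1) / ((n + 1).factorial : ℝ)) := by
      funext y
      rw [erlangTail, Finset.sum_range_succ, mul_add, erlangTail]
    rw [e]
    convert! ih.add ((hasDerivAt_neg x).exp.mul
      ((hasDerivAt_pow (n + 1) x).div_const ((n + 1).factorial : ℝ))) using 1
    rw [Nat.factorial_succ]
    push_cast
    have : (n.factorial : ℝ) ≠ 0 := by exact_mod_cast n.factorial_ne_zero
    field_simp
    simp

theorem tendsto_erlangTail (n : ℕ) : Filter.Tendsto (erlangTail n) Filter.atTop (nhds 0) := by
  have h : ∀ k : ℕ, Filter.Tendsto (fun x : ℝ => x ^ k * Real.exp (-x) / (k.factorial : ℝ))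
      Filter.atTop (nhds 0) := by
    intro k
    simpa using (Real.tendsto_pow_mul_exp_neg_atTop_nhds_zero k).div_const (k.factorial : ℝ)
  have h2 := tendsto_finsetSum (Finset.range n) fun k _ => h k
  simp only [Finset.sum_const_zero] at h2
  refine h2.congr fun x => ?_
  rw [erlangTail, Finset.mul_sum]
  exact Finset.sum_congr rfl fun k _ => by ring

theorem integral_Ioi_erlang (n : ℕ) {x : ℝ} (hx : 0 ≤ x) :
    ∫ t in Set.Ioi x, t ^ n * Real.exp (-t) / (n.factorial : ℝ) = erlangTail (n + 1) x := by
  have h := integral_Ioi_of_hasDerivAt_of_nonpos (a := x) (l := 0)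
    (continuous_erlangTail (n + 1)).continuousWithinAt
    (fun t _ => hasDerivAt_erlangTail n t)
    (fun t ht => by
      have : 0 < t := hx.trans_lt ht
      rw [neg_nonpos]; positivity)
    (tendsto_erlangTail (n + 1))
  rw [integral_neg] at h
  linarith

theorem upperGamma_nat {n : ℕ} (hn : 1 ≤ n) {x : ℝ} (hx : 0 ≤ x) :
    upperGamma n x / Real.Gamma n = erlangTail n x := by
  obtain ⟨k, rfl⟩ := Nat.exists_eq_add_of_le' hn
  rw [← integral_Ioi_erlang k hx, upperGamma, integral_div]
  push_cast
  rw [Real.Gamma_nat_eq_factorial]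
  congr 1
  refine setIntegral_congr_fun measurableSet_Ioi fun t _ => ?_
  simp [mul_comm]

theorem gammaMeasure_absolutelyContinuous (a r : ℝ) : gammaMeasure a r ≪ volume :=
  withDensity_absolutelyContinuous _ _

theorem gammaMeasure_nat_real_Ioi {n : ℕ} (hn : 1 ≤ n) {x : ℝ} (hx : 0 ≤ x) :
    (gammaMeasure n 1).real (Set.Ioi x) = erlangTail n x := by
  obtain ⟨k, rfl⟩ := Nat.exists_eq_add_of_le' hn
  have hpos : (0 : ℝ) < ((k + 1 : ℕ) : ℝ) := by positivity
  rw [← integral_Ioi_erlang k hx, Measure.real, gammaMeasure,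
    withDensity_apply _ measurableSet_Ioi]
  unfold gammaPDF
  rw [← integral_eq_lintegral_of_nonneg_ae
    (Filter.Eventually.of_forall fun t => gammaPDFReal_nonneg hpos one_pos t)
    (measurable_gammaPDFReal _ _).aestronglyMeasurable]
  refine setIntegral_congr_fun measurableSet_Ioi fun t ht => ?_
  have ht : 0 ≤ t := hx.trans (le_of_lt ht)
  simp only [gammaPDFReal, if_pos ht]
  push_cast
  rw [Real.Gamma_nat_eq_factorial]
  simp
  ring

theorem gammaMeasure_nat_real_Ici {n : ℕ} (hn : 1 ≤ n) {x : ℝ} (hx : 0 ≤ x) :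
    (gammaMeasure n 1).real (Set.Ici x) = erlangTail n x := by
  rw [← gammaMeasure_nat_real_Ioi hn hx]
  exact measureReal_congr
    ((gammaMeasure_absolutelyContinuous _ _).ae_eq Ioi_ae_eq_Ici.symm)

/-! ### Void probabilities and the law of the nearest user -/

theorem IsPoissonProcessOn.measurableSet_nonempty_inter {Ω : Type*} [MeasurableSpace Ω]
    {P : Measure Ω} {D : Set ℂ} {lam : ℝ} {Φ : Ω → Set ℂ} (h : IsPoissonProcessOn P D lam Φ)
    {A : Set ℂ} (hA : MeasurableSet A) : MeasurableSet {ω | (Φ ω ∩ A).Nonempty} := by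
  have e : {ω | (Φ ω ∩ A).Nonempty} = (fun ω => (Φ ω ∩ A).ncard) ⁻¹' {0}ᶜ := by
    ext ω
    simp [Set.ncard_eq_zero ((h.finite ω).inter_of_left A), Set.nonempty_iff_ne_empty]
  rw [e]
  exact h.measurable_count A hA (measurableSet_singleton 0).compl

/-- Probability that a Poisson process hits a set. -/
theorem IsPoissonProcessOn.real_nonempty_inter {Ω : Type*} [MeasurableSpace Ω]
    {P : Measure Ω} [IsProbabilityMeasure P] {D : Set ℂ} {lam : ℝ} {Φ : Ω → Set ℂ}
    (hlam : 0 ≤ lam) (h : IsPoissonProcessOn P D lam Φ) {A : Set ℂ} (hA : MeasurableSet A) :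
    P.real {ω | (Φ ω ∩ A).Nonempty} =
      1 - Real.exp (-(lam * (volume : Measure ℂ).real (A ∩ D))) := by
  have e : {ω | (Φ ω ∩ A).Nonempty} = ((fun ω => (Φ ω ∩ A).ncard) ⁻¹' {0})ᶜ := by
    ext ω
    simp [Set.ncard_eq_zero ((h.finite ω).inter_of_left A), Set.nonempty_iff_ne_empty]
  rw [e, probReal_compl_eq_one_sub (h.measurable_count A hA (measurableSet_singleton 0)),
    ← map_measureReal_apply (h.measurable_count A hA) (measurableSet_singleton 0),
    (h.law_count A hA).map_eq, poissonMeasure_real_singleton,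
    Real.coe_toNNReal _ (mul_nonneg hlam measureReal_nonneg)]
  simp

namespace NomaParams

theorem Admissible.real_closedBall_inter_ring {p : NomaParams} (hp : p.Admissible) {r : ℝ}
    (h2 : p.R₂ ≤ r) (h3 : r ≤ p.R₃) :
    (volume : Measure ℂ).real (Metric.closedBall 0 r ∩ p.ring) =
      Real.pi * (r ^ 2 - p.R₂ ^ 2) := by
  have e : Metric.closedBall 0 r ∩ p.ring = Metric.closedBall 0 r \ Metric.ball 0 p.R₂ := by
    ext z
    simp only [ring, Set.mem_inter_iff, Metric.mem_closedBall, dist_zero_right, Set.mem_ofPred_eq,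
      Set.mem_sdiff, Metric.mem_ball, not_lt]
    exact ⟨fun h => ⟨h.1, h.2.1⟩, fun h => ⟨h.1, h.2, h.1.trans h3⟩⟩
  have hr : 0 ≤ r := hp.R₂_pos.le.trans h2
  rw [e, measureReal_sdiff (Metric.ball_subset_closedBall.trans
    (Metric.closedBall_subset_closedBall h2)) measurableSet_ball
    measure_closedBall_lt_top.ne, Measure.real, Measure.real,
    Complex.volume_closedBall, Complex.volume_ball]
  simp [ENNReal.toReal_mul, ENNReal.toReal_ofReal hr, ENNReal.toReal_ofReal hp.R₂_pos.le]
  ring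

/-- Density of the distance of the nearest far user to the base station. -/
noncomputable def nearestDensity (p : NomaParams) (r : ℝ) : ℝ :=
  p.υf * r * Real.exp (-(Real.pi * p.lamF * (r ^ 2 - p.R₂ ^ 2)))

theorem Admissible.ring_mass_pos {p : NomaParams} (hp : p.Admissible) :
    0 < 1 - Real.exp (-(Real.pi * p.lamF * (p.R₃ ^ 2 - p.R₂ ^ 2))) := by
  have h : 0 < p.R₃ ^ 2 - p.R₂ ^ 2 := by
    have := hp.R₂_pos
    have := hp.R₂_lt_R₃
    nlinarith
  have := hp.lamF_pos
  have := Real.pi_pos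
  rw [sub_pos, Real.exp_lt_one_iff, neg_neg_iff_pos]
  positivity

theorem Admissible.υf_pos {p : NomaParams} (hp : p.Admissible) : 0 < p.υf := by
  have := hp.lamF_pos
  have := Real.pi_pos
  exact div_pos (by positivity) hp.ring_mass_pos

theorem Admissible.integral_nearestDensity {p : NomaParams} (hp : p.Admissible) (r : ℝ) :
    ∫ t in p.R₂..r, p.nearestDensity t =
      (1 - Real.exp (-(Real.pi * p.lamF * (r ^ 2 - p.R₂ ^ 2)))) /
        (1 - Real.exp (-(Real.pi * p.lamF * (p.R₃ ^ 2 - p.R₂ ^ 2)))) := by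
  have hZ := hp.ring_mass_pos
  have hd : ∀ t, HasDerivAt (fun r => -Real.exp (-(Real.pi * p.lamF * (r ^ 2 - p.R₂ ^ 2))) /
      (1 - Real.exp (-(Real.pi * p.lamF * (p.R₃ ^ 2 - p.R₂ ^ 2))))) (p.nearestDensity t) t := by
    intro t
    convert! (((((hasDerivAt_pow 2 t).sub_const (p.R₂ ^ 2)).const_mul
      (Real.pi * p.lamF)).neg.exp).neg.div_const _) using 1
    rw [nearestDensity, υf]
    simp
    ring
  rw [intervalIntegral.integral_eq_sub_of_hasDerivAt (fun t _ => hd t)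
    (Continuous.intervalIntegrable (by unfold nearestDensity; fun_prop) _ _)]
  simp
  ring

end NomaParams

section Model

variable {Ω : Type*} [MeasurableSpace Ω] {P : Measure Ω} {p : NomaParams}
  {h : Ω → Fin p.NR → ℂ} {H : Ω → Fin p.NR → Fin p.NT → ℂ} {f : Ω → Fin p.NT → ℂ}
  {Φ : Ω → Set ℂ} {U : Ω → ℂ} {w : Ω → Fin p.NT → ℂ}

theorem IsNNNFModel.measurableSet_nonempty (hM : IsNNNFModel P p h H f Φ U w) :
    MeasurableSet {ω | (Φ ω).Nonempty} := by
  simpa using hM.poisson.measurableSet_nonempty_inter MeasurableSet.univ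

theorem IsNNNFModel.ae_cond_mem_ring (hM : IsNNNFModel P p h H f Φ U w) :
    ∀ᵐ ω ∂cond P {ω | (Φ ω).Nonempty}, U ω ∈ p.ring := by
  filter_upwards [ae_cond_mem hM.measurableSet_nonempty] with ω hω
  exact hM.poisson.subset ω (hM.nearest_mem ω hω)

variable [IsProbabilityMeasure P]

theorem IsNNNFModel.real_nonempty (hM : IsNNNFModel P p h H f Φ U w) (hp : p.Admissible) :
    P.real {ω | (Φ ω).Nonempty} =
      1 - Real.exp (-(Real.pi * p.lamF * (p.R₃ ^ 2 - p.R₂ ^ 2))) := by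
  have h1 := hM.poisson.real_nonempty_inter hp.lamF_pos.le
    (A := Metric.closedBall 0 p.R₃) measurableSet_closedBall
  rw [hp.real_closedBall_inter_ring hp.R₂_lt_R₃.le le_rfl] at h1
  have e : ∀ ω, Φ ω ∩ Metric.closedBall 0 p.R₃ = Φ ω := fun ω =>
    Set.inter_eq_left.2 fun z hz => by simpa using (hM.poisson.subset ω hz).2
  simp only [e] at h1
  rw [h1]
  ring_nf

theorem IsNNNFModel.measure_nonempty_ne_zero (hM : IsNNNFModel P p h H f Φ U w)
    (hp : p.Admissible) : P {ω | (Φ ω).Nonempty} ≠ 0 := by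
  intro h0
  have h1 := hM.real_nonempty hp
  rw [Measure.real, h0] at h1
  exact hp.ring_mass_pos.ne h1

/-- The nearest user lies within `r` exactly when the process hits the closed disc of radius `r`, so
a void probability gives the distribution function. -/
theorem IsNNNFModel.cond_real_norm_le (hM : IsNNNFModel P p h H f Φ U w) (hp : p.Admissible)
    {r : ℝ} (h2 : p.R₂ ≤ r) (h3 : r ≤ p.R₃) :
    (cond P {ω | (Φ ω).Nonempty}).real {ω | ‖U ω‖ ≤ r} = ∫ t in p.R₂..r, p.nearestDensity t := by
  rw [hp.integral_nearestDensity, Measure.real, cond_apply hM.measurableSet_nonempty,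
    ENNReal.toReal_mul, ENNReal.toReal_inv, ← Measure.real, ← Measure.real, hM.real_nonempty hp]
  have e : {ω | (Φ ω).Nonempty} ∩ {ω | ‖U ω‖ ≤ r} =
      {ω | (Φ ω ∩ Metric.closedBall 0 r).Nonempty} := by
    ext ω
    constructor
    · rintro ⟨hne, hU⟩
      exact ⟨U ω, hM.nearest_mem ω hne, by simpa using hU⟩
    · rintro ⟨z, hz, hzr⟩
      exact ⟨⟨z, hz⟩, (hM.nearest_le ω z hz).trans (by simpa using hzr)⟩
  rw [e, hM.poisson.real_nonempty_inter hp.lamF_pos.le measurableSet_closedBall,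
    hp.real_closedBall_inter_ring h2 h3, div_eq_inv_mul]
  ring_nf

/-- Law of the distance of the nearest far user to the base station. -/
theorem IsNNNFModel.map_norm (hM : IsNNNFModel P p h H f Φ U w) (hp : p.Admissible) :
    (cond P {ω | (Φ ω).Nonempty}).map (fun ω => ‖U ω‖) =
      (volume.restrict (Set.Ioc p.R₂ p.R₃)).withDensity
        fun r => ENNReal.ofReal (p.nearestDensity r) := by
  have := cond_isProbabilityMeasure (hM.measure_nonempty_ne_zero hp)
  set Q := cond P {ω | (Φ ω).Nonempty}
  have hUm : Measurable fun ω => ‖U ω‖ := hM.measurable_U.norm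
  have : IsProbabilityMeasure (Q.map fun ω => ‖U ω‖) :=
    Measure.isProbabilityMeasure_map hUm.aemeasurable
  have hc : Continuous p.nearestDensity := by unfold NomaParams.nearestDensity; fun_prop
  have hv : ∀ r, p.R₂ ≤ r → ((volume.restrict (Set.Ioc p.R₂ p.R₃)).withDensity
      fun r => ENNReal.ofReal (p.nearestDensity r)) (Set.Iic r) =
        ENNReal.ofReal (∫ t in p.R₂..(min r p.R₃), p.nearestDensity t) := by
    intro r hr
    have e : Set.Iic r ∩ Set.Ioc p.R₂ p.R₃ = Set.Ioc p.R₂ (min r p.R₃) := by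
      ext t
      simp only [Set.mem_inter_iff, Set.mem_Iic, Set.mem_Ioc, le_min_iff]
      tauto
    rw [withDensity_apply _ measurableSet_Iic, Measure.restrict_restrict measurableSet_Iic, e,
      intervalIntegral.integral_of_le (le_min hr hp.R₂_lt_R₃.le),
      ofReal_integral_eq_lintegral_ofReal]
    · exact (hc.integrableOn_Icc).mono_set Set.Ioc_subset_Icc_self
    · filter_upwards [ae_restrict_mem measurableSet_Ioc] with t ht
      have := hp.R₂_pos.trans ht.1
      have := hp.υf_pos
      rw [NomaParams.nearestDensity]
      positivity
  apply Measure.ext_of_Iic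
  intro r
  rw [Measure.map_apply hUm measurableSet_Iic]
  change Q {ω | ‖U ω‖ ≤ r} = _
  -- Below `R₂` both distribution functions vanish and beyond `R₃` both equal one; in between
  -- `cond_real_norm_le` applies.
  rcases lt_or_ge r p.R₂ with h2 | h2
  · have e : Set.Iic r ∩ Set.Ioc p.R₂ p.R₃ = ∅ := by
      ext t
      simp only [Set.mem_inter_iff, Set.mem_Iic, Set.mem_Ioc, Set.mem_empty_iff_false, iff_false]
      rintro ⟨h1, h3, -⟩
      linarith
    rw [withDensity_apply _ measurableSet_Iic, Measure.restrict_restrict measurableSet_Iic, e]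
    simp only [Measure.restrict_empty, lintegral_zero_measure]
    have : ∀ᵐ ω ∂Q, ¬ ‖U ω‖ ≤ r := by
      filter_upwards [hM.ae_cond_mem_ring] with ω hω
      exact not_le.2 (h2.trans_le hω.1)
    simpa [ae_iff] using this
  rw [hv r h2]
  rcases le_or_gt r p.R₃ with h3 | h3
  · rw [min_eq_left h3, ← hM.cond_real_norm_le hp h2 h3, ofReal_measureReal]
  · rw [min_eq_right h3.le, hp.integral_nearestDensity, div_self hp.ring_mass_pos.ne',
      ENNReal.ofReal_one, ← mem_ae_iff_prob_eq_one (measurableSet_le hUm measurable_const)]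
    filter_upwards [hM.ae_cond_mem_ring] with ω hω
    exact hω.2.trans h3.le

theorem IsNNNFModel.integral_norm (hM : IsNNNFModel P p h H f Φ U w) (hp : p.Admissible)
    {g : ℝ → ℝ} (hg : Measurable g) :
    ∫ ω, g ‖U ω‖ ∂cond P {ω | (Φ ω).Nonempty} =
      ∫ r in p.R₂..p.R₃, p.nearestDensity r * g r := by
  have hc : Continuous p.nearestDensity := by unfold NomaParams.nearestDensity; fun_prop
  rw [← integral_map (f := g) (hM.measurable_U.norm.aemeasurable) hg.aestronglyMeasurable,
    hM.map_norm hp, integral_withDensity_eq_integral_toReal_smul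
      hc.measurable.ennreal_ofReal (by simp),
    intervalIntegral.integral_of_le hp.R₂_lt_R₃.le]
  refine setIntegral_congr_fun measurableSet_Ioc fun r hr => ?_
  have h1 := hp.R₂_pos.trans hr.1
  have h2 := hp.υf_pos
  have : 0 ≤ p.nearestDensity r := by
    rw [NomaParams.nearestDensity]; positivity
  simp [ENNReal.toReal_ofReal this]

/-- Conditioning keeps the independence because the presence of a user is an event of
`locationSigma`. It is read off the counts: `U` is arbitrary when there is no user and need not
reveal it. -/
theorem IsNNNFModel.map_channels_location (hM : IsNNNFModel P p h H f Φ U w)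
    (hp : p.Admissible) :
    (cond P {ω | (Φ ω).Nonempty}).map (fun ω => ((h ω, H ω, f ω), U ω)) =
      (((gaussianVectorLaw p.NR 1).prod
        ((gaussianMatrixLaw p.NR p.NT p.varRR).prod (gaussianVectorLaw p.NT 1)))).prod
        ((cond P {ω | (Φ ω).Nonempty}).map U) := by
  have hN := hM.measurableSet_nonempty
  have := cond_isProbabilityMeasure (hM.measure_nonempty_ne_zero hp)
  have := Measure.isProbabilityMeasure_map (μ := cond P {ω | (Φ ω).Nonempty})
    hM.measurable_U.aemeasurable
  have hch : Measurable fun ω => (h ω, H ω, f ω) :=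
    hM.measurable_h.prodMk (hM.measurable_H.prodMk hM.measurable_f)
  symm
  apply Measure.prod_eq
  intro B V hB hV
  have hloc : MeasurableSet[locationSigma Φ U] ({ω | (Φ ω).Nonempty} ∩ U ⁻¹' V) := by
    refine MeasurableSet.inter ?_ ?_
    · have e : {ω | (Φ ω).Nonempty} = (fun ω => (Φ ω ∩ Set.univ).ncard) ⁻¹' {0}ᶜ := by
        ext ω
        simp [Set.ncard_eq_zero (hM.poisson.finite ω), Set.nonempty_iff_ne_empty]
      rw [e]
      exact (le_sup_of_le_left (le_iSup (fun A : {A : Set ℂ // MeasurableSet A} =>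
        MeasurableSpace.comap (fun ω => (Φ ω ∩ A.1).ncard) inferInstance)
        ⟨Set.univ, MeasurableSet.univ⟩) : _ ≤ locationSigma Φ U) _
        ⟨{0}ᶜ, (measurableSet_singleton 0).compl, rfl⟩
    · exact (le_sup_right : _ ≤ locationSigma Φ U) _ ⟨V, hV, rfl⟩
  have hind := (Indep_iff _ _ P).1 hM.indep _ _ ⟨B, hB, rfl⟩ hloc
  rw [Measure.map_apply (hch.prodMk hM.measurable_U) (hB.prod hV),
    Measure.map_apply hM.measurable_U hV, cond_apply hN, cond_apply hN,
    ← hM.law_channels.map_eq, Measure.map_apply hch hB]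
  have e : {ω | (Φ ω).Nonempty} ∩ (fun ω => ((h ω, H ω, f ω), U ω)) ⁻¹' B ×ˢ V =
      (fun ω => (h ω, H ω, f ω)) ⁻¹' B ∩ ({ω | (Φ ω).Nonempty} ∩ U ⁻¹' V) := by
    ext ω
    simp only [Set.mem_inter_iff, Set.mem_ofPred_eq, Set.mem_preimage, Set.mem_prod]
    tauto
  rw [e, hind]
  ring

end Model

/-! ### The composite midpoint rule -/

/-- The linear Taylor term at the centre integrates to zero by symmetry. The mean value inequality
bounds the remainder by `K δ²` on an interval of length `2δ`. -/
theorem abs_integral_sub_midpoint_le {G G' : ℝ → ℝ} (hG : ∀ x, HasDerivAt G (G' x) x) {c δ K : ℝ}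
    (hδ : 0 ≤ δ) (hK : 0 ≤ K)
    (hL : ∀ x ∈ Set.Icc (c - δ) (c + δ), |G' x - G' c| ≤ K * |x - c|) :
    |(∫ x in (c - δ)..(c + δ), G x) - 2 * δ * G c| ≤ 2 * K * δ ^ 3 := by
  have hcont : Continuous G := continuous_iff_continuousAt.2 fun x => (hG x).continuousAt
  have habs : ∀ x ∈ Set.Icc (c - δ) (c + δ), |x - c| ≤ δ := fun x hx =>
    abs_le.2 ⟨by linarith [hx.1], by linarith [hx.2]⟩
  have hc : c ∈ Set.Icc (c - δ) (c + δ) := ⟨by linarith, by linarith⟩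
  have hb : ∀ x ∈ Set.Icc (c - δ) (c + δ), |G x - G c - G' c * (x - c)| ≤ K * δ ^ 2 := by
    intro x hx
    have h := Convex.norm_image_sub_le_of_norm_hasDerivWithin_le
      (f := fun x => G x - G' c * x) (f' := fun x => G' x - G' c) (C := K * δ)
      (s := Set.Icc (c - δ) (c + δ))
      (fun y _ => by
        have := ((hasDerivAt_id y).const_mul (G' c)).hasDerivWithinAt (s := Set.Icc (c - δ) (c + δ))
        rw [mul_one] at this
        exact (hG y).hasDerivWithinAt.sub this)
      (fun y hy => (hL y hy).trans (mul_le_mul_of_nonneg_left (habs y hy) hK))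
      (convex_Icc _ _) hc hx
    simp only [Real.norm_eq_abs] at h
    have e : G x - G' c * x - (G c - G' c * c) = G x - G c - G' c * (x - c) := by ring
    rw [e] at h
    refine h.trans ?_
    nlinarith [mul_le_mul_of_nonneg_left (habs x hx) (mul_nonneg hK hδ)]
  have hI : ∫ x in (c - δ)..(c + δ), (G x - G c - G' c * (x - c)) =
      (∫ x in (c - δ)..(c + δ), G x) - 2 * δ * G c := by
    rw [intervalIntegral.integral_sub, intervalIntegral.integral_sub,
      intervalIntegral.integral_const, intervalIntegral.integral_const_mul,
      intervalIntegral.integral_sub, integral_id, intervalIntegral.integral_const]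
    · simp only [smul_eq_mul]
      ring
    all_goals exact Continuous.intervalIntegrable (by fun_prop) _ _
  rw [← hI, ← Real.norm_eq_abs]
  have h := intervalIntegral.norm_integral_le_of_norm_le_const
    (f := fun x => G x - G c - G' c * (x - c)) (C := K * δ ^ 2) (a := c - δ) (b := c + δ)
    (fun x hx => by
      rw [Set.uIoc_of_le (by linarith)] at hx
      exact hb x (Set.Ioc_subset_Icc_self hx))
  refine h.trans (le_of_eq ?_)
  rw [show c + δ - (c - δ) = 2 * δ by ring, abs_of_nonneg (by linarith)]
  ring

/-- Error of the composite midpoint rule. -/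
theorem exists_midpoint_error {G : ℝ → ℝ} (hG : ContDiff ℝ 2 G) {b : ℝ} (hb : 0 ≤ b) :
    ∃ K : ℝ, ∀ M : ℕ, 1 ≤ M →
      |(∫ x in (0 : ℝ)..b, G x) -
        b / M * ∑ m ∈ Finset.Icc 1 M, G ((2 * (m : ℝ) - 1) / (2 * (M : ℝ)) * b)| ≤
          K / (M : ℝ) ^ 2 := by
  have hd : ∀ x, HasDerivAt G (deriv G x) x := fun x =>
    (hG.differentiable (by norm_num) x).hasDerivAt
  have h1 : ContDiff ℝ 1 (deriv G) := by
    have : ContDiff ℝ (1 + 1) G := by simpa [one_add_one_eq_two] using hG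
    exact (contDiff_succ_iff_deriv.1 this).2.2
  have hd2 : ∀ x, HasDerivAt (deriv G) (deriv (deriv G) x) x := fun x =>
    (h1.differentiable (by norm_num) x).hasDerivAt
  obtain ⟨K, hK⟩ := (isCompact_Icc (a := (0 : ℝ)) (b := b)).exists_bound_of_continuousOn
    (h1.continuous_deriv le_rfl).continuousOn
  have hK0 : 0 ≤ K := (norm_nonneg _).trans (hK 0 ⟨le_rfl, hb⟩)
  -- With half-width `δ = b / (2M)`, the `M` cells contribute `M * 2Kδ³ = (K b³ / 4) / M²`.
  refine ⟨K * b ^ 3 / 4, fun M hM => ?_⟩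
  have hM0 : (0 : ℝ) < M := by exact_mod_cast hM
  set δ := b / (2 * M) with hδ
  have hδ0 : 0 ≤ δ := by positivity
  have hMδ : 2 * M * δ = b := by rw [hδ]; field_simp
  have hsum : ∫ x in (0 : ℝ)..b, G x = ∑ k ∈ Finset.range M,
      ∫ x in (((2 * k + 1 : ℝ) * δ - δ))..((2 * k + 1 : ℝ) * δ + δ), G x := by
    have h := intervalIntegral.sum_integral_adjacent_intervals (μ := volume) (f := G)
      (a := fun k : ℕ => 2 * (k : ℝ) * δ) (n := M)
      (fun k _ => hG.continuous.intervalIntegrable _ _)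
    simp only [hMδ] at h
    rw [Nat.cast_zero, mul_zero, zero_mul] at h
    rw [← h]
    refine Finset.sum_congr rfl fun k _ => ?_
    congr 1
    · ring
    · push_cast; ring
  -- Node `m` is the midpoint `(2k + 1)δ` of cell `k = m - 1`.
  have hpts : b / M * ∑ m ∈ Finset.Icc 1 M, G ((2 * (m : ℝ) - 1) / (2 * (M : ℝ)) * b) =
      ∑ k ∈ Finset.range M, 2 * δ * G ((2 * k + 1 : ℝ) * δ) := by
    rw [← Finset.mul_sum, show b / M = 2 * δ by rw [hδ]; field_simp,
      ← Finset.Ico_add_one_right_eq_Icc, Finset.sum_Ico_eq_sum_range, Nat.add_sub_cancel]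
    congr 1
    refine Finset.sum_congr rfl fun k _ => ?_
    congr 1
    rw [hδ]
    push_cast
    ring
  rw [hsum, hpts, ← Finset.sum_sub_distrib]
  refine (Finset.abs_sum_le_sum_abs _ _).trans ?_
  have hterm : ∀ k ∈ Finset.range M,
      |(∫ x in (((2 * k + 1 : ℝ) * δ - δ))..((2 * k + 1 : ℝ) * δ + δ), G x) -
        2 * δ * G ((2 * k + 1 : ℝ) * δ)| ≤ 2 * K * δ ^ 3 := by
    intro k hk
    have hkM : (k : ℝ) + 1 ≤ M := by exact_mod_cast Finset.mem_range.1 hk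
    have hk0 : (0 : ℝ) ≤ k := k.cast_nonneg
    have hsub : Set.Icc ((2 * k + 1 : ℝ) * δ - δ) ((2 * k + 1 : ℝ) * δ + δ) ⊆ Set.Icc 0 b := by
      intro x hx
      have hl : 0 ≤ k * δ := mul_nonneg hk0 hδ0
      have hu : ((k : ℝ) + 1) * δ ≤ M * δ := mul_le_mul_of_nonneg_right hkM hδ0
      exact ⟨by linarith [hx.1], by linarith [hx.2]⟩
    refine abs_integral_sub_midpoint_le hd hδ0 hK0 fun x hx => ?_
    exact Convex.norm_image_sub_le_of_norm_hasDerivWithin_le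
      (fun y _ => (hd2 y).hasDerivWithinAt) hK (convex_Icc 0 b)
      (hsub ⟨by linarith, by linarith⟩) (hsub hx)
  refine (Finset.sum_le_sum hterm).trans (le_of_eq ?_)
  rw [Finset.sum_const, Finset.card_range, nsmul_eq_mul, hδ]
  field_simp
  ring

/-! ### The closed form as a midpoint rule -/

namespace NomaParams

/-- Affine map from `[-1, 1]` to `[R₂, R₃]`. -/
noncomputable def affineNode (p : NomaParams) (x : ℝ) : ℝ := (p.R₃ - p.R₂) / 2 * (x + 1) + p.R₂

/-- Density of the nearest distance times the conditional success probability of the second hop. -/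
noncomputable def successDensity (p : NomaParams) (r : ℝ) : ℝ :=
  p.nearestDensity r * erlangTail (p.NT - 1) (p.β * r ^ p.α)

theorem Admissible.le_affineNode {p : NomaParams} (hp : p.Admissible) {x : ℝ} (hx : -1 ≤ x) :
    p.R₂ ≤ p.affineNode x := by
  have := hp.R₂_lt_R₃
  have : 0 ≤ (p.R₃ - p.R₂) / 2 * (x + 1) := mul_nonneg (by linarith) (by linarith)
  unfold affineNode
  linarith

theorem Admissible.affineNode_cos_pos {p : NomaParams} (hp : p.Admissible) (t : ℝ) :
    0 < p.affineNode (Real.cos t) :=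
  hp.R₂_pos.trans_le (hp.le_affineNode (Real.neg_one_le_cos t))

theorem Admissible.continuous_successDensity {p : NomaParams} (hp : p.Admissible) :
    Continuous p.successDensity := by
  unfold successDensity nearestDensity
  have h1 : Continuous fun r : ℝ => r ^ p.α :=
    Real.continuous_rpow_const (by linarith [hp.two_le_α])
  have h2 := continuous_erlangTail (p.NT - 1)
  fun_prop

/-- The real power is smooth away from 0, and the node never falls below `R₂ > 0`, so smoothness
holds for all `t`. -/
theorem Admissible.contDiff_successDensity_cos {p : NomaParams} (hp : p.Admissible) :
    ContDiff ℝ 2 fun t => p.successDensity (p.affineNode (Real.cos t)) * Real.sin t := by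
  have h0 : ContDiff ℝ 2 fun t => p.affineNode (Real.cos t) := by
    unfold affineNode; fun_prop
  have h1 : ContDiff ℝ 2 fun t => p.affineNode (Real.cos t) ^ p.α :=
    h0.rpow_const_of_ne fun t => (hp.affineNode_cos_pos t).ne'
  unfold successDensity nearestDensity erlangTail
  fun_prop

theorem Admissible.integral_successDensity {p : NomaParams} (hp : p.Admissible) :
    ∫ r in p.R₂..p.R₃, p.successDensity r =
      (p.R₃ - p.R₂) / 2 *
        ∫ t in (0 : ℝ)..Real.pi, p.successDensity (p.affineNode (Real.cos t)) * Real.sin t := by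
  have hd : ∀ t, HasDerivAt (fun t => p.affineNode (Real.cos t))
      ((p.R₃ - p.R₂) / 2 * -Real.sin t) t := fun t => by
    unfold affineNode
    exact (((Real.hasDerivAt_cos t).add_const 1).const_mul _).add_const _
  have h := intervalIntegral.integral_comp_mul_deriv (a := 0) (b := Real.pi)
    (f := fun t => p.affineNode (Real.cos t)) (f' := fun t => (p.R₃ - p.R₂) / 2 * -Real.sin t)
    (g := p.successDensity) (fun t _ => hd t) (by fun_prop) hp.continuous_successDensity
  have e0 : p.affineNode (Real.cos 0) = p.R₃ := by simp [affineNode]; ring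
  have e1 : p.affineNode (Real.cos Real.pi) = p.R₂ := by simp [affineNode]
  rw [e0, e1, intervalIntegral.integral_symm p.R₂] at h
  rw [← neg_inj, ← h, ← intervalIntegral.integral_const_mul, ← intervalIntegral.integral_neg]
  refine intervalIntegral.integral_congr fun t _ => ?_
  simp only [Function.comp]
  ring

/-- The Chebyshev angles are the midpoints of `M` equal cells of `[0, π]`. There `√(1 - φ²)` is `sin
t`, the Jacobian of `cos`, and the normalized incomplete Gamma factor is the first-hop success
probability. -/
theorem Admissible.outageFormula_eq {p : NomaParams} (hp : p.Admissible) {M : ℕ} (hM : 1 ≤ M) :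
    p.outageFormula M = 1 - erlangTail p.NR p.relayThreshold * ((p.R₃ - p.R₂) / 2 *
      (Real.pi / M * ∑ m ∈ Finset.Icc 1 M,
        p.successDensity (p.affineNode (Real.cos ((2 * (m : ℝ) - 1) / (2 * (M : ℝ)) * Real.pi))) *
          Real.sin ((2 * (m : ℝ) - 1) / (2 * (M : ℝ)) * Real.pi))) := by
  have hM0 : (0 : ℝ) < M := by exact_mod_cast hM
  rw [outageFormula, ← upperGamma_nat hp.one_le_NR hp.relayThreshold_pos.le, relayThreshold]
  set A := upperGamma p.NR (p.τ₂ * p.R₁ ^ p.α / (p.ρs * (p.a₂ - p.τ₂ * p.a₁)))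
  have key : ∀ m ∈ Finset.Icc 1 M,
      p.successDensity (p.affineNode (Real.cos ((2 * (m : ℝ) - 1) / (2 * (M : ℝ)) * Real.pi))) *
          Real.sin ((2 * (m : ℝ) - 1) / (2 * (M : ℝ)) * Real.pi) =
      p.υf * Real.exp (Real.pi * p.lamF * p.R₂ ^ 2) * ∑ k ∈ Finset.range (p.NT - 1),
        p.β ^ k / (k.factorial : ℝ) * (√(1 - φ M m ^ 2) * p.s M m ^ (p.α * k + 1) *
        Real.exp (-(p.β * p.s M m ^ p.α + Real.pi * p.lamF * p.s M m ^ 2))) := by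
    intro m hm
    have hm1 : (1 : ℝ) ≤ m := by exact_mod_cast (Finset.mem_Icc.1 hm).1
    have hm2 : (m : ℝ) ≤ M := by exact_mod_cast (Finset.mem_Icc.1 hm).2
    set t := (2 * (m : ℝ) - 1) / (2 * (M : ℝ)) * Real.pi with ht
    have hφ : φ M m = Real.cos t := rfl
    have hs : p.s M m = p.affineNode (Real.cos t) := rfl
    have hsin : √(1 - φ M m ^ 2) = Real.sin t := by
      have h0 : 0 ≤ t := mul_nonneg (div_nonneg (by linarith) (by linarith)) Real.pi_pos.le
      have h1 : t ≤ Real.pi := by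
        have : (2 * (m : ℝ) - 1) / (2 * (M : ℝ)) ≤ 1 := by
          rw [div_le_one (by positivity)]; linarith
        rw [ht]
        nlinarith [Real.pi_pos]
      rw [hφ, ← Real.sin_sq, Real.sqrt_sq (Real.sin_nonneg_of_nonneg_of_le_pi h0 h1)]
    have hpos := hp.affineNode_cos_pos t
    rw [hsin, hs, successDensity, nearestDensity, erlangTail]
    set r := p.affineNode (Real.cos t)
    simp only [Finset.mul_sum, Finset.sum_mul]
    refine Finset.sum_congr rfl fun k _ => ?_
    have e1 : r ^ (p.α * k + 1) = (r ^ p.α) ^ k * r := by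
      rw [Real.rpow_add hpos, Real.rpow_mul hpos.le, Real.rpow_natCast, Real.rpow_one]
    have e2 : Real.exp (-(Real.pi * p.lamF * (r ^ 2 - p.R₂ ^ 2))) * Real.exp (-(p.β * r ^ p.α)) =
        Real.exp (Real.pi * p.lamF * p.R₂ ^ 2) *
          Real.exp (-(p.β * r ^ p.α + Real.pi * p.lamF * r ^ 2)) := by
      rw [← Real.exp_add, ← Real.exp_add]
      ring_nf
    rw [e1, mul_pow]
    linear_combination (p.υf * r * (p.β ^ k * (r ^ p.α) ^ k / k.factorial) * Real.sin t) * e2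
  rw [Finset.sum_congr rfl key, ← Finset.mul_sum, Finset.sum_comm, b₄]
  simp only [Finset.mul_sum]
  congr 1
  refine Finset.sum_congr rfl fun k _ => Finset.sum_congr rfl fun m _ => ?_
  field_simp

/-- The closed form converges at rate `M⁻²`. -/
theorem Admissible.exists_outageFormula_error {p : NomaParams} (hp : p.Admissible) :
    ∃ E : ℝ, ∀ M : ℕ, 1 ≤ M →
      |(1 - erlangTail p.NR p.relayThreshold * ∫ r in p.R₂..p.R₃, p.successDensity r) -
        p.outageFormula M| ≤ E / (M : ℝ) ^ 2 := by
  obtain ⟨K, hK⟩ := exists_midpoint_error hp.contDiff_successDensity_cos Real.pi_pos.le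
  refine ⟨|erlangTail p.NR p.relayThreshold * ((p.R₃ - p.R₂) / 2)| * K, fun M hM => ?_⟩
  rw [hp.outageFormula_eq hM, hp.integral_successDensity, mul_div_assoc]
  refine le_trans (le_of_eq ?_) (mul_le_mul_of_nonneg_left (hK M hM) (abs_nonneg _))
  rw [← abs_mul, ← abs_neg]
  congr 1
  ring

end NomaParams

/-! ### Stability under replacing the relay distance -/

theorem erlangTail_nonneg (n : ℕ) {x : ℝ} (hx : 0 ≤ x) : 0 ≤ erlangTail n x := by
  unfold erlangTail; positivity

theorem erlangTail_le_one (n : ℕ) {x : ℝ} (hx : 0 ≤ x) : erlangTail n x ≤ 1 := by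
  rw [erlangTail, Real.exp_neg, inv_mul_le_iff₀ (Real.exp_pos x), mul_one]
  exact Real.sum_le_exp_of_nonneg hx n

/-- On the logarithmic scale the derivative is, up to sign, `α (k + 1)` times the Poisson weight
`e^{-x} x^(k+1) / (k+1)!`, which is at most one. The scale `β` drops out. -/
theorem abs_erlangTail_exp_sub_le (k : ℕ) {α β : ℝ} (hα : 0 ≤ α) (hβ : 0 < β) (u v : ℝ) :
    |erlangTail (k + 1) (β * Real.exp (α * u)) - erlangTail (k + 1) (β * Real.exp (α * v))| ≤
      α * (k + 1) * |u - v| := by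
  have hd : ∀ t : ℝ, HasDerivAt (fun t => erlangTail (k + 1) (β * Real.exp (α * t)))
      (-((β * Real.exp (α * t)) ^ k * Real.exp (-(β * Real.exp (α * t))) / (k.factorial : ℝ)) *
        (β * (Real.exp (α * t) * α))) t := fun t => by
    have h1 : HasDerivAt (fun t => β * Real.exp (α * t)) (β * (Real.exp (α * t) * α)) t := by
      simpa using (((hasDerivAt_id t).const_mul α).exp).const_mul β
    exact (hasDerivAt_erlangTail k (β * Real.exp (α * t))).comp t h1
  refine Convex.norm_image_sub_le_of_norm_hasDerivWithin_le (s := Set.univ)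
    (fun t _ => (hd t).hasDerivWithinAt) (fun t _ => ?_) convex_univ (Set.mem_univ v)
    (Set.mem_univ u)
  have hx : 0 < β * Real.exp (α * t) := by positivity
  have e : -((β * Real.exp (α * t)) ^ k * Real.exp (-(β * Real.exp (α * t))) /
      (k.factorial : ℝ)) * (β * (Real.exp (α * t) * α)) =
      -(α * (k + 1) * ((β * Real.exp (α * t)) ^ (k + 1) / ((k + 1).factorial : ℝ) *
        Real.exp (-(β * Real.exp (α * t))))) := by
    rw [Nat.factorial_succ]
    push_cast
    field_simp
    ring
  rw [e, norm_neg, Real.norm_of_nonneg (by positivity)]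
  refine mul_le_of_le_one_right (by positivity) ?_
  rw [Real.exp_neg, ← div_eq_mul_inv, div_le_one (Real.exp_pos _)]
  exact Real.pow_div_factorial_le_exp _ hx.le _

/-- Stability of the success probability of the second hop under a perturbation of the distance. -/
theorem abs_erlangTail_rpow_sub_le {n : ℕ} (hn : 1 ≤ n) {α β R₁ R₂ d r : ℝ} (hα : 2 ≤ α)
    (hβ : 0 < β) (h1 : 0 < R₁) (h12 : R₁ < R₂) (hr : R₂ ≤ r) (hdr : |d - r| ≤ R₁) :
    |erlangTail n (β * d ^ α) - erlangTail n (β * r ^ α)| ≤ 2 * α * n * (R₁ / R₂) := by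
  have h2 : 0 < R₂ := h1.trans h12
  have hr0 : 0 < r := h2.trans_le hr
  obtain ⟨hd1, hd2⟩ := abs_le.1 hdr
  have hd0 : 0 < d := by linarith
  have hn' : (1 : ℝ) ≤ n := by exact_mod_cast hn
  set t := R₁ / R₂ with ht
  have ht0 : 0 < t := by positivity
  -- For `t ≤ 1/2`, `(1 - t)(1 + 2t) ≥ 1` bounds `r / d` by `1 + 2t`, which controls the logarithm
  -- from below. For `t > 1/2` the claimed bound exceeds 1, since `α n ≥ 2`, and is trivial.
  rcases le_or_gt t (1 / 2) with hle | hgt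
  · obtain ⟨k, rfl⟩ := Nat.exists_eq_add_of_le' hn
    have hR : R₁ = t * R₂ := by rw [ht]; field_simp
    have hR' : R₁ ≤ t * r := hR.le.trans (mul_le_mul_of_nonneg_left hr ht0.le)
    have hlow : 1 - t ≤ d / r := by rw [le_div_iff₀ hr0]; linarith
    have hupp : d / r ≤ 1 + t := by rw [div_le_iff₀ hr0]; linarith
    have hq : 0 < d / r := by positivity
    have hlog : |Real.log d - Real.log r| ≤ 2 * t := by
      rw [← Real.log_div hd0.ne' hr0.ne', abs_le]
      constructor
      · have h3 := Real.one_sub_inv_le_log_of_pos hq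
        have h4 : (d / r)⁻¹ ≤ 1 + 2 * t := by
          rw [inv_le_iff_one_le_mul₀ hq]
          nlinarith
        linarith
      · have h3 := Real.log_le_sub_one_of_pos hq
        linarith
    have h := abs_erlangTail_exp_sub_le k (by linarith : 0 ≤ α) hβ (Real.log d) (Real.log r)
    rw [mul_comm α (Real.log d), mul_comm α (Real.log r), ← Real.rpow_def_of_pos hd0,
      ← Real.rpow_def_of_pos hr0] at h
    refine h.trans ?_
    push_cast
    have := mul_le_mul_of_nonneg_left hlog (by positivity : 0 ≤ α * ((k : ℝ) + 1))
    linarith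
  · have hx : 0 ≤ β * d ^ α := by positivity
    have hy : 0 ≤ β * r ^ α := by positivity
    have : |erlangTail n (β * d ^ α) - erlangTail n (β * r ^ α)| ≤ 1 := by
      rw [abs_le]
      constructor <;> linarith [erlangTail_nonneg n hx, erlangTail_nonneg n hy,
        erlangTail_le_one n hx, erlangTail_le_one n hy]
    refine this.trans ?_
    have h3 : 2 ≤ α * n := by nlinarith
    nlinarith

namespace NomaParams

theorem norm_relayPos (p : NomaParams) (k : Fin p.K) : ‖p.relayPos k‖ = |p.R₁| := by
  rw [relayPos, norm_mul, Complex.norm_exp_ofReal_mul_I, mul_one, Complex.norm_real,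
    Real.norm_eq_abs]

theorem Admissible.abs_relayDist_sub_norm_le {p : NomaParams} (hp : p.Admissible) (u : ℂ) :
    |p.relayDist u - ‖u‖| ≤ p.R₁ := by
  have : Nonempty (Fin p.K) := ⟨⟨0, hp.one_le_K⟩⟩
  have hk : ∀ k, |dist (p.relayPos k) u - ‖u‖| ≤ p.R₁ := by
    intro k
    have h := abs_norm_sub_norm_le (u - p.relayPos k) u
    rw [sub_sub_cancel_left, norm_neg, p.norm_relayPos, abs_of_pos hp.R₁_pos, ← dist_eq_norm,
      dist_comm] at h
    exact h
  obtain ⟨k, hkm⟩ := exists_eq_ciInf_of_finite (f := fun k : Fin p.K => dist (p.relayPos k) u)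
  rw [relayDist, ← hkm]
  exact hk k

theorem measurable_relayDist (p : NomaParams) : Measurable p.relayDist := by
  unfold relayDist
  exact Measurable.iInf fun k => by fun_prop

end NomaParams

/-! ### The outage probability and the comparison of the two distances -/

theorem NomaParams.Admissible.one_le_NT_sub_one {p : NomaParams} (hp : p.Admissible) :
    1 ≤ p.NT - 1 := by
  have := hp.two_le_NT
  omega

/-- Fubini applied to the complement, whose slice at `u` is the closed half-line from `t u`. -/
theorem real_prod_lt_eq {G : Measure ℝ} [IsProbabilityMeasure G] {ν : Measure ℂ}
    [IsProbabilityMeasure ν] {t : ℂ → ℝ} (ht : Measurable t) {F : ℝ → ℝ} (hF : Continuous F)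
    (hG : ∀ u, G.real (Set.Ici (t u)) = F (t u)) :
    (G.prod ν).real {q | q.1 < t q.2} = 1 - ∫ u, F (t u) ∂ν := by
  have hs : MeasurableSet {q : ℝ × ℂ | t q.2 ≤ q.1} :=
    measurableSet_le (ht.comp measurable_snd) measurable_fst
  have e : {q : ℝ × ℂ | q.1 < t q.2} = {q : ℝ × ℂ | t q.2 ≤ q.1}ᶜ := by
    ext q
    simp
  have hpre : ∀ u, (fun x => (x, u)) ⁻¹' {q : ℝ × ℂ | t q.2 ≤ q.1} = Set.Ici (t u) := fun u => rfl
  rw [e, probReal_compl_eq_one_sub hs, Measure.real, Measure.prod_apply_symm hs]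
  simp_rw [hpre]
  rw [integral_eq_lintegral_of_nonneg_ae (f := fun u => F (t u))
    (Filter.Eventually.of_forall fun u => by
      simp only [Pi.zero_apply, ← hG]
      exact measureReal_nonneg)
    (hF.measurable.comp ht).aestronglyMeasurable]
  congr 2
  refine lintegral_congr fun u => ?_
  rw [← hG, ofReal_measureReal]

section Model

variable {Ω : Type*} [MeasurableSpace Ω] {P : Measure Ω} {p : NomaParams}
  {h : Ω → Fin p.NR → ℂ} {H : Ω → Fin p.NR → Fin p.NT → ℂ} {f : Ω → Fin p.NT → ℂ}
  {Φ : Ω → Set ℂ} {U : Ω → ℂ} {w : Ω → Fin p.NT → ℂ}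

theorem IsNNNFModel.ae_vecMul_ne_zero (hM : IsNNNFModel P p h H f Φ U w) (hp : p.Admissible) :
    ∀ᵐ ω ∂P, star (h ω) ᵥ* Matrix.of (H ω) ≠ 0 := by
  have h0 := ae_vecMul_star_ne_zero hp.one_le_NR (one_le_two.trans hp.two_le_NT) hp.varRR_pos
  have h1 := (measurePreserving_prodAssoc (gaussianVectorLaw p.NR 1)
    (gaussianMatrixLaw p.NR p.NT p.varRR) (gaussianVectorLaw p.NT 1)).symm
    MeasurableEquiv.prodAssoc
  have h2 := (measurePreserving_fst.comp h1).quasiMeasurePreserving.ae h0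
  rw [← hM.law_channels.map_eq] at h2
  exact ae_of_ae_map hM.law_channels.aemeasurable h2

variable [IsProbabilityMeasure P]

/-- Given that there is a far user, the channel gains and its location are independent. -/
theorem IsNNNFModel.measurePreserving_gains_location (hM : IsNNNFModel P p h H f Φ U w)
    (hp : p.Admissible) :
    MeasurePreserving (fun ω => (∑ i, ‖h ω i‖ ^ 2,
        (orthNormSq (star (h ω) ᵥ* Matrix.of (H ω)) (f ω), U ω)))
      (cond P {ω | (Φ ω).Nonempty})
      ((gammaMeasure p.NR 1).prod ((gammaMeasure (p.NT - 1 : ℕ) 1).prod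
        ((cond P {ω | (Φ ω).Nonempty}).map U))) := by
  have := cond_isProbabilityMeasure (hM.measure_nonempty_ne_zero hp)
  have := Measure.isProbabilityMeasure_map (μ := cond P {ω | (Φ ω).Nonempty})
    hM.measurable_U.aemeasurable
  have := isProbabilityMeasure_gammaMeasure_nat hp.one_le_NR
  have := isProbabilityMeasure_gammaMeasure_nat hp.one_le_NT_sub_one
  have h1 : MeasurePreserving (fun ω => ((h ω, H ω, f ω), U ω)) (cond P {ω | (Φ ω).Nonempty}) _ :=
    ⟨(hM.measurable_h.prodMk (hM.measurable_H.prodMk hM.measurable_f)).prodMk hM.measurable_U,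
      hM.map_channels_location hp⟩
  have h2 := (measurePreserving_channelGains hp.one_le_NR hp.two_le_NT hp.varRR_pos).prod
    (MeasurePreserving.id ((cond P {ω | (Φ ω).Nonempty}).map U))
  have h3 := measurePreserving_prodAssoc (gammaMeasure p.NR 1) (gammaMeasure (p.NT - 1 : ℕ) 1)
    ((cond P {ω | (Φ ω).Nonempty}).map U)
  exact h3.comp (h2.comp h1)

/-- Outage probability in terms of the distance that enters the path loss. -/
theorem IsNNNFModel.nnnfOutage_eq (hM : IsNNNFModel P p h H f Φ U w) (hp : p.Admissible)
    {d : ℂ → ℝ} (hdm : Measurable d) (hd0 : ∀ u, 0 ≤ d u) (hd : ∀ u ∈ p.ring, 0 < d u) :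
    nnnfOutage P p h H f Φ w (fun ω => d (U ω)) =
      nnnfOutageSplit P p h H f Φ w (fun ω => d (U ω)) ∧
    nnnfOutage P p h H f Φ w (fun ω => d (U ω)) =
      1 - erlangTail p.NR p.relayThreshold *
        ∫ ω, erlangTail (p.NT - 1) (p.β * d (U ω) ^ p.α) ∂cond P {ω | (Φ ω).Nonempty} := by
  have := cond_isProbabilityMeasure (hM.measure_nonempty_ne_zero hp)
  have := Measure.isProbabilityMeasure_map (μ := cond P {ω | (Φ ω).Nonempty})
    hM.measurable_U.aemeasurable
  have := isProbabilityMeasure_gammaMeasure_nat hp.one_le_NR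
  have := isProbabilityMeasure_gammaMeasure_nat hp.one_le_NT_sub_one
  have hmp := hM.measurePreserving_gains_location hp
  have hac : cond P {ω | (Φ ω).Nonempty} ≪ P := cond_absolutelyContinuous
  have hne := hac.ae_le (hM.ae_vecMul_ne_zero hp)
  have htzf := hac.ae_le hM.tzf
  have hring := hM.ae_cond_mem_ring
  unfold nnnfOutage nnnfOutageSplit outageProb outageProbSplit
  set Q := cond P {ω | (Φ ω).Nonempty}
  set ν := Q.map U
  set x₀ := p.relayThreshold
  set t : ℂ → ℝ := fun u => p.β * d u ^ p.α with ht
  have htm : Measurable t := by fun_prop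
  have ht0 : ∀ u, 0 ≤ t u := fun u =>
    mul_nonneg hp.β_pos.le (Real.rpow_nonneg (hd0 u) _)
  set S : Ω → ℝ := fun ω => ∑ i, ‖h ω i‖ ^ 2
  set X : Ω → ℝ := fun ω => orthNormSq (star (h ω) ᵥ* Matrix.of (H ω)) (f ω)
  have hcmp : ∀ᵐ ω ∂Q,
      (relaySINR p (h ω) (H ω) (mrc (h ω)) (w ω) < p.τ₂ ↔ S ω < x₀) ∧
      (p.τ₂ < relaySINR p (h ω) (H ω) (mrc (h ω)) (w ω) ↔ x₀ < S ω) ∧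
      (farSNR p (d (U ω)) (f ω) (w ω) < p.τ₂ ↔ X ω < t (U ω)) := by
    filter_upwards [hne, htzf, hring] with ω h1 h2 h3
    rw [relaySINR_mrc h2.2.1, hp.farSNR_lt_iff (hd _ h3), h2.norm_sq_eq h1]
    have h4 := hp.sinr_cmp (s := S ω) (Finset.sum_nonneg fun _ _ => by positivity)
    exact ⟨h4.1, h4.2, Iff.rfl⟩
  -- The beamformer `w` is not assumed measurable, so the events are replaced, up to null sets, by
  -- measurable events in the gains and `U`.
  have hset : ∀ A B : Set Ω, (∀ᵐ ω ∂Q, ω ∈ A ↔ ω ∈ B) → Q.real A = Q.real B := fun A B hAB =>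
    measureReal_congr (Filter.eventuallyEq_set.2 hAB)
  have e1 : Q.real {ω | relaySINR p (h ω) (H ω) (mrc (h ω)) (w ω) < p.τ₂} =
      (gammaMeasure p.NR 1).real (Set.Iio x₀) := by
    rw [hset _ {ω | S ω < x₀} (by filter_upwards [hcmp] with ω hω using hω.1)]
    exact (measurePreserving_fst.comp hmp).measureReal_preimage
      measurableSet_Iio.nullMeasurableSet
  have e2 : Q.real {ω | p.τ₂ < relaySINR p (h ω) (H ω) (mrc (h ω)) (w ω)} =
      (gammaMeasure p.NR 1).real (Set.Ioi x₀) := by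
    rw [hset _ {ω | x₀ < S ω} (by filter_upwards [hcmp] with ω hω using hω.2.1)]
    exact (measurePreserving_fst.comp hmp).measureReal_preimage
      measurableSet_Ioi.nullMeasurableSet
  have hT : MeasurableSet {q : ℝ × ℂ | q.1 < t q.2} :=
    measurableSet_lt measurable_fst (htm.comp measurable_snd)
  have e3 : Q.real {ω | farSNR p (d (U ω)) (f ω) (w ω) < p.τ₂} =
      ((gammaMeasure (p.NT - 1 : ℕ) 1).prod ν).real {q | q.1 < t q.2} := by
    rw [hset _ {ω | X ω < t (U ω)} (by filter_upwards [hcmp] with ω hω using hω.2.2)]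
    exact (measurePreserving_snd.comp hmp).measureReal_preimage hT.nullMeasurableSet
  have e4 : Q.real {ω | relaySINR p (h ω) (H ω) (mrc (h ω)) (w ω) < p.τ₂ ∨
      (p.τ₂ < relaySINR p (h ω) (H ω) (mrc (h ω)) (w ω) ∧
        farSNR p (d (U ω)) (f ω) (w ω) < p.τ₂)} =
      (gammaMeasure p.NR 1).real (Set.Iio x₀) + (gammaMeasure p.NR 1).real (Set.Ioi x₀) *
        ((gammaMeasure (p.NT - 1 : ℕ) 1).prod ν).real {q | q.1 < t q.2} := by
    rw [hset _ ({ω | S ω < x₀} ∪ {ω | x₀ < S ω ∧ X ω < t (U ω)}) (by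
      filter_upwards [hcmp] with ω hω
      exact or_congr hω.1 (and_congr hω.2.1 hω.2.2))]
    have hB : MeasurableSet {ω | x₀ < S ω ∧ X ω < t (U ω)} :=
      hmp.measurable (measurableSet_Ioi.prod hT)
    have hdisj : Disjoint {ω | S ω < x₀} {ω | x₀ < S ω ∧ X ω < t (U ω)} :=
      Set.disjoint_left.2 fun ω h1 h2 => lt_asymm (Set.mem_ofPred.1 h1) (Set.mem_ofPred.1 h2).1
    rw [measureReal_union hdisj hB,
      ← measureReal_prod_prod]
    congr 1
    · exact (measurePreserving_fst.comp hmp).measureReal_preimage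
        measurableSet_Iio.nullMeasurableSet
    · exact hmp.measureReal_preimage (measurableSet_Ioi.prod hT).nullMeasurableSet
  refine ⟨by rw [e4, e1, e2, e3], ?_⟩
  have hx₀ : 0 ≤ x₀ := hp.relayThreshold_pos.le
  have hIio : (gammaMeasure p.NR 1).real (Set.Iio x₀) = 1 - erlangTail p.NR x₀ := by
    rw [← gammaMeasure_nat_real_Ici hp.one_le_NR hx₀, ← probReal_compl_eq_one_sub measurableSet_Ici,
      Set.compl_Ici]
  rw [e4, hIio, gammaMeasure_nat_real_Ioi hp.one_le_NR hx₀,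
    real_prod_lt_eq htm (continuous_erlangTail (p.NT - 1))
      (fun u => gammaMeasure_nat_real_Ici hp.one_le_NT_sub_one (ht0 u)),
    integral_map (f := fun u => erlangTail (p.NT - 1) (t u)) hM.measurable_U.aemeasurable
      ((continuous_erlangTail (p.NT - 1)).measurable.comp htm).aestronglyMeasurable]
  ring

theorem IsNNNFModel.nnnfOutage_norm_eq (hM : IsNNNFModel P p h H f Φ U w) (hp : p.Admissible) :
    nnnfOutage P p h H f Φ w (fun ω => ‖U ω‖) =
      1 - erlangTail p.NR p.relayThreshold * ∫ r in p.R₂..p.R₃, p.successDensity r := by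
  have hm : Measurable fun r : ℝ => erlangTail (p.NT - 1) (p.β * r ^ p.α) :=
    (continuous_erlangTail _).measurable.comp (by fun_prop)
  rw [(hM.nnnfOutage_eq hp measurable_norm (fun _ => norm_nonneg _)
    (fun u hu => hp.R₂_pos.trans_le hu.1)).2, hM.integral_norm hp hm]
  rfl

theorem NomaParams.Admissible.relayDist_pos {p : NomaParams} (hp : p.Admissible) {u : ℂ}
    (hu : u ∈ p.ring) : 0 < p.relayDist u := by
  have h1 := (abs_le.1 (hp.abs_relayDist_sub_norm_le u)).1
  have h2 := hp.R₁_lt_R₂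
  have h3 := hu.1
  linarith

theorem NomaParams.relayDist_nonneg (p : NomaParams) (u : ℂ) : 0 ≤ p.relayDist u :=
  Real.iInf_nonneg fun _ => dist_nonneg

/-- The outage probabilities for the two distances are close when the relays are near the base
station. -/
theorem IsNNNFModel.abs_nnnfOutage_sub_le (hM : IsNNNFModel P p h H f Φ U w)
    (hp : p.Admissible) :
    |nnnfOutage P p h H f Φ w (fun ω => p.relayDist (U ω)) -
      nnnfOutage P p h H f Φ w (fun ω => ‖U ω‖)| ≤
        2 * p.α * (p.NT - 1 : ℕ) * (p.R₁ / p.R₂) := by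
  have := cond_isProbabilityMeasure (hM.measure_nonempty_ne_zero hp)
  rw [(hM.nnnfOutage_eq hp p.measurable_relayDist p.relayDist_nonneg
    (fun _ => hp.relayDist_pos)).2, (hM.nnnfOutage_eq hp measurable_norm (fun _ => norm_nonneg _)
    (fun u hu => hp.R₂_pos.trans_le hu.1)).2]
  set Q := cond P {ω | (Φ ω).Nonempty}
  have hint : ∀ d : ℂ → ℝ, Measurable d → (∀ u, 0 ≤ d u) →
      Integrable (fun ω => erlangTail (p.NT - 1) (p.β * d (U ω) ^ p.α)) Q := by
    intro d hdm hd0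
    have hU := hM.measurable_U
    refine Integrable.of_bound ((continuous_erlangTail _).measurable.comp
      (by fun_prop)).aestronglyMeasurable 1 (Filter.Eventually.of_forall fun ω => ?_)
    have hx : 0 ≤ p.β * d (U ω) ^ p.α := mul_nonneg hp.β_pos.le (Real.rpow_nonneg (hd0 _) _)
    rw [Real.norm_of_nonneg (erlangTail_nonneg _ hx)]
    exact erlangTail_le_one _ hx
  have hx₀ := hp.relayThreshold_pos.le
  have hA := erlangTail_nonneg p.NR hx₀
  rw [sub_sub_sub_cancel_left, ← mul_sub, ← integral_sub (hint _ measurable_norm fun _ =>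
    norm_nonneg _) (hint _ p.measurable_relayDist p.relayDist_nonneg), abs_mul, abs_of_nonneg hA]
  refine (mul_le_of_le_one_left (abs_nonneg _) (erlangTail_le_one _ hx₀)).trans ?_
  have hb := norm_integral_le_of_norm_le_const (μ := Q)
    (f := fun ω => erlangTail (p.NT - 1) (p.β * ‖U ω‖ ^ p.α) -
      erlangTail (p.NT - 1) (p.β * p.relayDist (U ω) ^ p.α))
    (C := 2 * p.α * (p.NT - 1 : ℕ) * (p.R₁ / p.R₂)) (by
      filter_upwards [hM.ae_cond_mem_ring] with ω hω
      rw [Real.norm_eq_abs, abs_sub_comm]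
      exact abs_erlangTail_rpow_sub_le hp.one_le_NT_sub_one hp.two_le_α hp.β_pos hp.R₁_pos
        hp.R₁_lt_R₂ hω.1 (hp.abs_relayDist_sub_norm_le _))
  simpa using hb

end Model

theorem proposition4 :
    ∃ C : ℝ → ℕ → ℝ, ∀ p : NomaParams, p.Admissible → ∃ E : ℝ,
      ∀ (Ω : Type*) [MeasurableSpace Ω] (P : Measure Ω) [IsProbabilityMeasure P]
        (h : Ω → Fin p.NR → ℂ) (H : Ω → Fin p.NR → Fin p.NT → ℂ) (f : Ω → Fin p.NT → ℂ)
        (Φ : Ω → Set ℂ) (U : Ω → ℂ) (w : Ω → Fin p.NT → ℂ),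
        IsNNNFModel P p h H f Φ U w →
        -- both forms of the outage probability agree, for the true distance to the selected relay
        -- and for its approximation by the distance to the base station
        nnnfOutage P p h H f Φ w (fun ω => p.relayDist (U ω)) =
          nnnfOutageSplit P p h H f Φ w (fun ω => p.relayDist (U ω)) ∧
        nnnfOutage P p h H f Φ w (fun ω => ‖U ω‖) =
          nnnfOutageSplit P p h H f Φ w (fun ω => ‖U ω‖) ∧
        ∀ M : ℕ, 1 ≤ M →
          |nnnfOutage P p h H f Φ w (fun ω => ‖U ω‖) - p.outageFormula M| ≤ E / (M : ℝ) ^ 2 ∧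
          |nnnfOutage P p h H f Φ w (fun ω => p.relayDist (U ω)) - p.outageFormula M| ≤
            C p.α p.NT * (p.R₁ / p.R₂) + E / (M : ℝ) ^ 2 := by
  -- The factor `n - 1` is the shape of the second-hop gain. `E` is purely a quadrature constant, so
  -- it can be fixed before the probability space.
  refine ⟨fun α n => 2 * α * (n - 1 : ℕ), fun p hp => ?_⟩
  obtain ⟨E, hE⟩ := hp.exists_outageFormula_error
  refine ⟨E, fun Ω _ P _ h H f Φ U w hM => ⟨?_, ?_, fun M hM1 => ?_⟩⟩
  · exact (hM.nnnfOutage_eq hp p.measurable_relayDist p.relayDist_nonneg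
      fun _ => hp.relayDist_pos).1
  · exact (hM.nnnfOutage_eq hp measurable_norm (fun _ => norm_nonneg _)
      fun u hu => hp.R₂_pos.trans_le hu.1).1
  · have h1 := hE M hM1
    rw [← hM.nnnfOutage_norm_eq hp] at h1
    exact ⟨h1, (abs_sub_le _ _ _).trans (add_le_add (hM.abs_nnnfOutage_sub_le hp) h1)⟩
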